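/- There are $n\ge 1$ agents and $m\ge 2n$ indivisible items $e_1,\dots,e_m$. An allocation $A=(A_1,\dots,A_n)$ is a partition of the set $M$ of all items into $n$ (possibly empty) bundles, bundle $A_i$ going to agent $i$. Each agent $i$ has a private additive valuation $v_i(S)=\sum_{e\in S}v_i(e)$ with real item values $v_i(e)\ge 0$; a valuation is binary if every item has value $0$ or $1$. Fairness. $A$ is *Prop1* if for every $i$ either $v_i(A_i)\ge \frac1n v_i(M)$ or $v_i(A_i)+v_i(e)>\frac1n v_i(M)$ for some item $e\notin A_i$. The truncated proportional share $TPS(v,S,\frac1n)$ is $\frac1n v(S)$ if no item $e\in S$ has $v(e)>\frac1n v(S)$, and otherwise equals $TPS(v,S\setminus\{e\},\frac1{n-1})$ for any such item $e$. $A$ is *Aprop* if it is Prop1 and $v_i(A_i)\ge\frac{n}{2n-1}TPS(v_i,M,\frac1n)$ for every $i$. $A$ is *semi-contiguous* if the sequence $e_1,\dots,e_m$ can be cut into $n$ blocks of consecutive items (some possibly empty) and at most $n$ items can be designated as holes, such that each agent receives the non-hole items of a block of her own, together with at most one hole. Complexity. In a deterministic protocol, agents are asked arbitrary queries about their own valuations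 and reply in bits, each query depending on the previous replies; the transcript determines the output allocation, and the cost is the number of bits transmitted by the agents. $CC(F)$ is the least worst-case cost of a protocol that outputs an allocation acceptable under $F$ on every instance of the class considered. In a randomized protocol a common random string selects a deterministic protocol (always correct), and $RCC(F)$ is the least worst-case expected cost. The description complexity $DC(F)$ is the deterministic complexity when all queries go to one special agent who knows all valuations. Logarithms are to base $2$; the constants hidden in $O(\cdot)$ and $\Omega(\cdot)$ are absolute. **Theorem.** 1. For additive valuations, $CC(\mathrm{Aprop})=O(n\log m\log n)$, and in fact $CC(\mathrm{Aprop})\le(1+o(1))\,n\log m\log n$, where the $o(1)$ term depends only on $n$ and tends to $0$ as $n\to\infty$. Also $RCC(\mathrm{Aprop})=O(n\log m)$. 2. For additive valuations, a semi-contiguous Aprop allocation always exists, and $DC(\mathrm{Aprop})=O(n\log m)$. 3. For $n\ge2$, $RCC(\mathrm{Prop1})=\Omega(n\log\frac mn)$ even on the class of instances in which all agents have the same binary valuation. In particular, $RCC(\mathrm{Aprop})=\Omega(n\log\frac mn)$ for additive valuations. 4. On the class of instances in which all agents have the same additive valuation, $CC(\mathrm{Aprop})$ and $RCC(\mathrm{Aprop})$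 are both $O(n\log\frac mn)$, and for $n\ge2$ both are $\Theta(n\log\frac mn)$. -/

import Mathlib

open scoped ENNReal NNReal Topology

noncomputable section

namespace FairAllocation

/-! ### Communication protocols -/

/-- A deterministic multi-party protocol with agents `ι`, private inputs in `X` and outputs in `R`:
a finite binary tree. At an inner node an arbitrary yes/no question about her private input is
put to one agent, who transmits a single bit (longer replies are sequences of bits). At a leaf the
protocol announces an output. -/
inductive Protocol (ι X R : Type) : Type
  | output (r : R) : Protocol ι X R
  | ask (i : ι) (q : X → Bool) (next : Bool → Protocol ι X R) : Protocol ι X R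

namespace Protocol

variable {ι X R : Type}

/-- The output of the protocol when agent `i` holds the private input `x i`. -/
def run : Protocol ι X R → (ι → X) → R
  | output r, _ => r
  | ask i q next, x => run (next (q (x i))) x

/-- The length of the transcript, i.e. the total number of bits transmitted by the agents. -/
def cost : Protocol ι X R → (ι → X) → ℕ
  | output _, _ => 0
  | ask i q next, x => cost (next (q (x i))) x + 1

/-- The protocol outputs an acceptable result (`F x r`) on every instance `x` of the class `C`. -/
def Solves (P : Protocol ι X R) (F : (ι → X) → R → Prop) (C : Set (ι → X)) : Prop :=
  ∀ x ∈ C, F x (P.run x)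

end Protocol

/-- A randomized protocol: a common random string `ω`, drawn from a probability space, selects
the deterministic protocol that is being run. -/
structure RandProtocol (ι X R : Type) : Type 1 where
  /-- the space of common random strings -/
  Ω : Type
  [mΩ : MeasurableSpace Ω]
  /-- the law of the common random string -/
  μ : MeasureTheory.Measure Ω
  [prob : MeasureTheory.IsProbabilityMeasure μ]
  /-- the deterministic protocol selected by the common random string -/
  prot : Ω → Protocol ι X R
  measurable_cost : ∀ x : ι → X, Measurable fun ω => (prot ω).cost x

namespace RandProtocol

variable {ι X R : Type}

/-- The expected length of the transcript, over the choice of the common random string. -/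
def expCost (P : RandProtocol ι X R) (x : ι → X) : ℝ≥0∞ :=
  MeasureTheory.lintegral (m := P.mΩ) P.μ fun ω => ((P.prot ω).cost x : ℝ≥0∞)

/-- Whatever the common random string, the output is acceptable on every instance of the class. -/
def Solves (P : RandProtocol ι X R) (F : (ι → X) → R → Prop) (C : Set (ι → X)) : Prop :=
  ∀ ω, (P.prot ω).Solves F C

end RandProtocol

section Complexity

variable {ι X R : Type}

/-- Deterministic communication complexity `CC(F, C)`: the least worst-case number of transmitted
bits of a deterministic protocol that is correct on the class `C`. -/
def detCC (F : (ι → X) → R → Prop) (C : Set (ι → X)) : ℝ≥0∞ :=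
  ⨅ (P : Protocol ι X R) (_ : P.Solves F C), ⨆ x ∈ C, (P.cost x : ℝ≥0∞)

/-- Randomized communication complexity `RCC(F, C)`: the least worst-case expected number of
transmitted bits of a randomized protocol that is correct on the class `C`. -/
def randCC (F : (ι → X) → R → Prop) (C : Set (ι → X)) : ℝ≥0∞ :=
  ⨅ (P : RandProtocol ι X R) (_ : P.Solves F C), ⨆ x ∈ C, P.expCost x

/-- Description complexity `DC(F, C)`: the communication complexity when there is one special agent
who knows the inputs of all agents, and all queries are directed to her. -/
def descC (F : (ι → X) → R → Prop) (C : Set (ι → X)) : ℝ≥0∞ :=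
  detCC (ι := Unit) (X := ι → X) (fun w r => F (w ()) r) {w | w () ∈ C}

end Complexity

/-! ### Allocation of indivisible items under additive valuations -/

/-- An additive valuation on the items `e_0, …, e_{m-1}`, given by the values of the items. -/
abbrev Valuation (m : ℕ) : Type := Fin m → ℝ≥0

/-- The value `v(S)` of a set of items. -/
def Valuation.value {m : ℕ} (v : Valuation m) (S : Finset (Fin m)) : ℝ := ∑ e ∈ S, (v e : ℝ)

/-- An allocation of `m` items to `n` agents, given by the owner of each item. -/
abbrev Allocation (n m : ℕ) : Type := Fin m → Fin n

/-- The set of items that agent `i` receives. -/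
def Allocation.bundle {n m : ℕ} (A : Allocation n m) (i : Fin n) : Finset (Fin m) :=
  Finset.univ.filter fun e => A e = i

/-- The proportional share of an agent when the items `S` are shared by `n` agents. -/
def propShare {m : ℕ} (v : Valuation m) (n : ℕ) (S : Finset (Fin m)) : ℝ := v.value S / n

open Classical in
/-- The truncated proportional share of an agent when the items `S` are shared by `n` agents: as
long as there is an over-proportional item, remove one such item and one agent. (For `n = 1` no item
is over-proportional, so the value at `n = 0` is not used when starting from `n ≥ 1`.) -/
def tps {m : ℕ} (v : Valuation m) : ℕ → Finset (Fin m) → ℝ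
  | 0, _ => 0
  | n + 1, S =>
    if h : ∃ e ∈ S, propShare v (n + 1) S < (v e : ℝ) then tps v n (S.erase h.choose)
    else propShare v (n + 1) S

/-- Prop1 allocations: each agent gets her proportional share, or would get strictly more than it
with one additional item. -/
def Prop1 {n m : ℕ} (v : Fin n → Valuation m) (A : Allocation n m) : Prop :=
  ∀ i, propShare (v i) n Finset.univ ≤ (v i).value (A.bundle i) ∨
    ∃ e, e ∉ A.bundle i ∧ propShare (v i) n Finset.univ < (v i).value (A.bundle i) + (v i e : ℝ)

/-- `ρ`-TPS allocations: each agent gets at least a `ρ` fraction of her truncated proportional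
share. -/
def IsTPS (ρ : ℝ) {n m : ℕ} (v : Fin n → Valuation m) (A : Allocation n m) : Prop :=
  ∀ i, ρ * tps (v i) n Finset.univ ≤ (v i).value (A.bundle i)

/-- Approximately proportional allocations: both Prop1 and `n / (2n - 1)`-TPS. -/
def Aprop {n m : ℕ} (v : Fin n → Valuation m) (A : Allocation n m) : Prop :=
  Prop1 v A ∧ IsTPS ((n : ℝ) / (2 * (n : ℝ) - 1)) v A

/-- Semi-contiguous allocations: the sequence of items is cut into `n` consecutive, possibly empty
blocks (`blk e` is the number of the block that contains `e`), and at most `n` items are designated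
as holes. Each agent gets a distinct block without the holes in it (agent `i` gets block `σ i`),
and in addition at most one hole. -/
def SemiContiguous {n m : ℕ} (A : Allocation n m) : Prop :=
  ∃ (blk : Fin m → Fin n) (holes : Finset (Fin m)) (σ : Equiv.Perm (Fin n)),
    Monotone blk ∧ holes.card ≤ n ∧ (∀ e, e ∉ holes → blk e = σ (A e)) ∧
      Set.InjOn A (holes : Set (Fin m))

/-- All instances with `n` agents that have additive valuations over `m` items. -/
def additive (n m : ℕ) : Set (Fin n → Valuation m) := Set.univ

/-- Instances in which all agents have the same additive valuation. -/
def identical (n m : ℕ) : Set (Fin n → Valuation m) := {v | ∃ u : Valuation m, ∀ i, v i = u}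

/-- Instances in which all agents have the same binary additive valuation. -/
def identicalBinary (n m : ℕ) : Set (Fin n → Valuation m) :=
  {v | ∃ u : Valuation m, (∀ e, u e = 0 ∨ u e = 1) ∧ ∀ i, v i = u}

end FairAllocation

end

open FairAllocation

open FairAllocation

/-! Upper bounds. Fix an agent with truncated share t, truncate her item values at t, and put θ = n
t / (2n - 1), so that n t = (2n - 1) θ and t = 2θ - θ/n. A set is "sufficient for k agents"
(`Suffices`) if it is worth at least (2k - 1) θ and meets a Prop1-type condition at k t. The set of
all items is sufficient for n (`suffices_univ`), and a bundle sufficient for one agent gives Aprop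
(`aprop_of_suffices`). Sufficiency survives two operations. Giving away a items costs at most a t ≤
2aθ (`Suffices.of_card`). If A is not sufficient for a agents and only one item worth less than θ
separates A from B, then B is sufficient for the other b agents (`Suffices.of_not_suffices`). So a
knife moving along the items can divide them for a + b agents, unless it meets a big item, worth at
least θ.

Big items are dealt with beforehand. In turn, each agent who sees a free item that is sufficient on
its own takes one. Of two big items either one is sufficient alone, so an agent still waiting has at
most one free big item (`eq_of_isBig`). She announces it, and it becomes a hole tied to one slot in
the order of the blocks. The waiting agents are then halved recursively: each names a cut acceptable
on both sides (`exists_cut`), and those with the lower cuts go left of a threshold cut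
(`Solvable.divideAndConquer`).

With everybody reporting her cut, a level of the recursion costs n log m bits up to rounding, and
there are about log n levels. Selecting the threshold with random pivots costs O(k + √k log m)
expected bits among k agents (`Solvable.quickselect`). The square root makes the log m terms of the
recursion sum to O(n log m), and the linear terms sum to O(n log n). Correctness of the protocol
also proves that structured allocations exist. Encoding the blocks and holes gives the description
bound; when all valuations are equal there is at most one hole besides the taken items, agents can
be renamed freely, and O(n log (m/n)) bits suffice (`detCC_identical_le`).

Lower bound. Let a common binary valuation be 1 on half of 2nq items. Prop1 then forces exactly q
valuable items into each bundle, so one allocation serves at most C(2q,q)^n of the C(2nq,nq)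
instances (`card_balanced_le`). An entropy argument (`le_randCC_of_card`) bounds the expected cost
below by the logarithm of the quotient, of order n log q. -/

namespace FairAllocation

/-! ### Sequential composition of protocols -/

namespace Protocol

variable {ι X R R' : Type}

/-- Sequential composition of protocols. -/
def bind : Protocol ι X R → (R → Protocol ι X R') → Protocol ι X R'
  | output r, f => f r
  | ask i q next, f => ask i q fun b => bind (next b) f

lemma run_bind (P : Protocol ι X R) (f : R → Protocol ι X R') (x : ι → X) :
    (P.bind f).run x = (f (P.run x)).run x := by
  induction P with
  | output r => rfl
  | ask i q next ih => simpa [bind, run] using ih (q (x i))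

lemma cost_bind (P : Protocol ι X R) (f : R → Protocol ι X R') (x : ι → X) :
    (P.bind f).cost x = P.cost x + (f (P.run x)).cost x := by
  induction P with
  | output r => simp [bind, run, cost]
  | ask i q next ih => simp only [bind, run, cost, ih (q (x i))]; ring

end Protocol

/-! ### Solvability with uniform finite randomness -/

section Solvable

variable {ι X R R' : Type}

/-- There is a protocol, selected by a uniformly random element of a finite set (and deterministic
unless `rand` holds), that is always correct on `S` and has expected cost at most `β x` on the
input `x`. -/
def Solvable (rand : Prop) (S : Set (ι → X)) (F : (ι → X) → R → Prop) (β : (ι → X) → ℝ) : Prop :=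
  ∃ (Ω : Type) (_ : Fintype Ω) (_ : Nonempty Ω) (P : Ω → Protocol ι X R),
    (¬ rand → Subsingleton Ω) ∧ ∀ x ∈ S, (∀ ω, F x ((P ω).run x)) ∧
      ∑ ω, ((P ω).cost x : ℝ) ≤ Fintype.card Ω * β x

variable {rand : Prop} {S S' : Set (ι → X)} {F F' : (ι → X) → R → Prop} {β β' : (ι → X) → ℝ}

lemma Solvable.mono (h : Solvable rand S F β) (hS : S' ⊆ S)
    (hF : ∀ x ∈ S', ∀ r, F x r → F' x r) (hβ : ∀ x ∈ S', β x ≤ β' x) :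
    Solvable rand S' F' β' := by
  obtain ⟨Ω, iΩ, nΩ, P, hs, h⟩ := h
  refine ⟨Ω, iΩ, nΩ, P, hs, fun x hx => ⟨fun ω => hF x hx _ ((h x (hS hx)).1 ω), ?_⟩⟩
  exact (h x (hS hx)).2.trans (mul_le_mul_of_nonneg_left (hβ x hx) (Nat.cast_nonneg _))

lemma Solvable.pure (r : R) (h : ∀ x ∈ S, F x r) (hβ : ∀ x ∈ S, 0 ≤ β x) :
    Solvable rand S F β :=
  ⟨Unit, inferInstance, inferInstance, fun _ => .output r, fun _ => inferInstance,
    fun x hx => ⟨fun _ => h x hx, by simpa [Protocol.cost] using hβ x hx⟩⟩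

lemma Solvable.exists_output (h : Solvable rand S F β) {x : ι → X} (hx : x ∈ S) : ∃ r, F x r := by
  obtain ⟨Ω, _, ⟨ω⟩, P, hs, h⟩ := h
  exact ⟨_, (h x hx).1 ω⟩

lemma Solvable.askBit (i : ι) (q : X → Bool) :
    Solvable rand (Set.univ : Set (ι → X)) (fun x r => r = q (x i)) (fun _ => 1) :=
  ⟨Unit, inferInstance, inferInstance, fun _ => .ask i q fun b => .output b,
    fun _ => inferInstance, fun x _ => by simp [Protocol.run, Protocol.cost]⟩

-- Each coordinate of a uniform element of a product is uniform; the identity is written without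
-- division.
open Classical in
lemma sum_apply_pi {J : Type} [Fintype J] {Ω : J → Type} [∀ j, Fintype (Ω j)] (j : J)
    (g : Ω j → ℝ) : (Fintype.card (Ω j) : ℝ) * ∑ ω : ∀ j, Ω j, g (ω j) =
      Fintype.card (∀ j, Ω j) * ∑ ω, g ω := by
  have h1 : ∑ ω : ∀ j, Ω j, g (ω j) =
      ∑ ω : Ω j × (∀ i : {i // i ≠ j}, Ω i), g ω.1 :=
    Fintype.sum_equiv (Equiv.piSplitAt j Ω) _ _ (fun ω => rfl)
  have h2 := Fintype.card_congr (Equiv.piSplitAt j Ω)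
  rw [h1, h2, Fintype.sum_prod_type, Fintype.card_prod]
  simp only [Finset.sum_const, Finset.card_univ, nsmul_eq_mul, ← Finset.mul_sum]
  push_cast
  ring

open Classical in
lemma sum_apply_pi_le {J : Type} [Fintype J] {Ω : J → Type}
    [∀ j, Fintype (Ω j)] [∀ j, Nonempty (Ω j)] (j : J) (g : Ω j → ℝ) {b : ℝ}
    (hb : ∑ ω, g ω ≤ Fintype.card (Ω j) * b) :
    ∑ ω : ∀ j, Ω j, g (ω j) ≤ Fintype.card (∀ j, Ω j) * b := by
  have hpos : (0 : ℝ) < Fintype.card (Ω j) := by exact_mod_cast Fintype.card_pos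
  have h := sum_apply_pi j g
  refine le_of_mul_le_mul_left ?_ hpos
  rw [h]
  exact (mul_le_mul_of_nonneg_left hb (Nat.cast_nonneg _)).trans (le_of_eq (by ring))

lemma Solvable.bind [Finite R'] {F₁ : (ι → X) → R' → Prop} {β₁ β₂ : (ι → X) → ℝ}
    (h₁ : Solvable rand S F₁ β₁)
    (h₂ : ∀ r, Solvable rand {x | x ∈ S ∧ F₁ x r} F β₂) :
    Solvable rand S F (fun x => β₁ x + β₂ x) := by
  classical
  have := Fintype.ofFinite R'
  obtain ⟨Ω₁, _, _, P₁, hs₁, h₁⟩ := h₁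
  choose Ω₂ hF hN P₂ hs₂ h₂ using h₂
  refine ⟨Ω₁ × (∀ r, Ω₂ r), inferInstance, inferInstance,
    fun ω => (P₁ ω.1).bind fun r => P₂ r (ω.2 r), fun hr => ?_, fun x hx => ⟨fun ω => ?_, ?_⟩⟩
  · have := hs₁ hr
    have := fun r => hs₂ r hr
    infer_instance
  · rw [Protocol.run_bind]
    exact (h₂ _ x ⟨hx, (h₁ x hx).1 _⟩).1 _
  · simp only [Protocol.cost_bind, Nat.cast_add, Finset.sum_add_distrib, Fintype.card_prod,
      Nat.cast_mul, mul_add, Fintype.sum_prod_type]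
    refine add_le_add ?_ ?_
    · simp only [Finset.sum_const, Finset.card_univ, nsmul_eq_mul, ← Finset.mul_sum]
      have := mul_le_mul_of_nonneg_left (h₁ x hx).2
        (Nat.cast_nonneg (α := ℝ) (Fintype.card (∀ r, Ω₂ r)))
      linarith
    · have : ∀ ω ∈ (Finset.univ : Finset Ω₁), ∑ ω₂ : ∀ r, Ω₂ r,
          (((P₂ ((P₁ ω).run x) (ω₂ ((P₁ ω).run x))).cost x : ℕ) : ℝ) ≤
            Fintype.card (∀ r, Ω₂ r) * β₂ x := fun ω _ =>
        sum_apply_pi_le ((P₁ ω).run x)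
          (fun ω₂ => (((P₂ ((P₁ ω).run x) ω₂).cost x : ℕ) : ℝ))
          (h₂ _ x ⟨hx, (h₁ x hx).1 ω⟩).2
      refine (Finset.sum_le_sum this).trans (le_of_eq ?_)
      simp [mul_assoc]

/-- A uniformly random index selects the protocol to run, so the cost bounds average. They may
depend on the input: the cost of a fixed pivot depends on its rank among the keys. -/
lemma Solvable.flip {J : Type} [Fintype J] [Nonempty J] {β : J → (ι → X) → ℝ}
    (h : ∀ j, Solvable True S F (β j)) :
    Solvable True S F (fun x => (∑ j, β j x) / Fintype.card J) := by
  classical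
  choose Ω hF hN P hs h using h
  refine ⟨J × (∀ j, Ω j), inferInstance, inferInstance, fun ω => P ω.1 (ω.2 ω.1),
    fun hr => absurd trivial hr, fun x hx => ⟨fun ω => (h _ x hx).1 _, ?_⟩⟩
  have hJ : (Fintype.card J : ℝ) ≠ 0 := by simp
  rw [Fintype.sum_prod_type, Fintype.card_prod]
  refine (Finset.sum_le_sum (fun j _ => sum_apply_pi_le j
    (fun ω => ((P j ω).cost x : ℝ)) (h j x hx).2)).trans (le_of_eq ?_)
  rw [← Finset.mul_sum]
  push_cast
  field_simp

lemma Solvable.map {F₁ : (ι → X) → R' → Prop} (h : Solvable rand S F₁ β) (f : R' → R)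
    (hf : ∀ x ∈ S, ∀ r, F₁ x r → F x (f r)) : Solvable rand S F β := by
  obtain ⟨Ω, iΩ, nΩ, P, hs, h⟩ := h
  refine ⟨Ω, iΩ, nΩ, fun ω => (P ω).bind fun r => .output (f r), hs,
    fun x hx => ⟨fun ω => ?_, ?_⟩⟩
  · rw [Protocol.run_bind]
    exact hf x hx _ ((h x hx).1 ω)
  · simpa [Protocol.cost_bind, Protocol.cost] using (h x hx).2

lemma Solvable.askBits (i : ι) (d : ℕ) (f : X → Fin d → Bool) :
    Solvable rand (Set.univ : Set (ι → X)) (fun x r => r = f (x i)) (fun _ => d) := by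
  induction d with
  | zero => exact Solvable.pure (fun j => j.elim0) (fun x _ => funext fun j => j.elim0) (by simp)
  | succ d ih =>
    refine ((Solvable.askBit i fun y => f y 0).bind (F := fun x r => r = f (x i))
      (β₂ := fun _ => d) fun b => ?_).mono subset_rfl (fun _ _ _ h => h)
      (fun x _ => by push_cast; linarith)
    refine ((ih fun y j => f y j.succ).mono (Set.subset_univ _) (fun _ _ _ h => h)
      (fun _ _ => le_rfl)).map (fun r => Fin.cons b r) ?_
    rintro x ⟨-, rfl⟩ r rfl
    exact Fin.cons_self_tail (f (x i))

/-- A question with at most `2 ^ d` possible answers is answered with `d` bits. -/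
lemma Solvable.ask {α : Type} [Fintype α] [Nonempty α] (i : ι) (f : X → α) {d : ℕ}
    (hd : Fintype.card α ≤ 2 ^ d) :
    Solvable rand (Set.univ : Set (ι → X)) (fun x r => r = f (x i)) (fun _ => d) := by
  classical
  have : Nonempty (α ↪ (Fin d → Bool)) := Function.Embedding.nonempty_of_card_le (by simpa using hd)
  obtain ⟨φ⟩ := this
  refine (Solvable.askBits i d fun y => φ (f y)).map (Function.invFun φ) ?_
  rintro x - r rfl
  exact Function.leftInverse_invFun φ.injective _

lemma Solvable.detCC_le {d : ℝ} (h : Solvable False S F (fun _ => d)) :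
    detCC F S ≤ ENNReal.ofReal d := by
  obtain ⟨Ω, iΩ, ⟨ω⟩, P, hs, h⟩ := h
  have := hs id
  refine (iInf₂_le (P ω) fun x hx => (h x hx).1 ω).trans (iSup₂_le fun x hx => ?_)
  have h2 := (h x hx).2
  rw [Fintype.sum_subsingleton _ ω, Fintype.card_eq_one_iff.2 ⟨ω, fun _ => Subsingleton.elim _ _⟩]
    at h2
  rw [← ENNReal.ofReal_natCast]
  exact ENNReal.ofReal_le_ofReal (by simpa using h2)

lemma Solvable.randCC_le {d : ℝ} (h : Solvable rand S F (fun _ => d)) :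
    randCC F S ≤ ENNReal.ofReal d := by
  obtain ⟨Ω, iΩ, nΩ, P, hs, h⟩ := h
  let Q : RandProtocol ι X R :=
    { Ω := Ω
      mΩ := ⊤
      μ := @PMF.toMeasure Ω ⊤ (PMF.uniformOfFintype Ω)
      prob := @PMF.toMeasure.isProbabilityMeasure Ω ⊤ _
      prot := P
      measurable_cost := fun x => measurable_from_top }
  refine (iInf₂_le Q fun ω x hx => (h x hx).1 ω).trans (iSup₂_le fun x hx => ?_)
  have h2 := (h x hx).2
  have hc : (0 : ℝ) < Fintype.card Ω := by exact_mod_cast Fintype.card_pos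
  have h3 : Q.expCost x = (Fintype.card Ω : ℝ≥0∞)⁻¹ * ((∑ ω, (P ω).cost x : ℕ) : ℝ≥0∞) := by
    let _ : MeasurableSpace Ω := ⊤
    have : MeasurableSingletonClass Ω := ⟨fun _ => trivial⟩
    change ∫⁻ ω, ((P ω).cost x : ℝ≥0∞) ∂(PMF.uniformOfFintype Ω).toMeasure = _
    rw [MeasureTheory.lintegral_fintype, Nat.cast_sum, Finset.mul_sum]
    refine Finset.sum_congr rfl fun ω _ => ?_
    rw [PMF.toMeasure_apply_singleton _ _ (measurableSet_singleton ω),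
      PMF.uniformOfFintype_apply, mul_comm]
  rw [h3, ← ENNReal.ofReal_natCast, ← ENNReal.ofReal_natCast, ← ENNReal.ofReal_inv_of_pos hc,
    ← ENNReal.ofReal_mul (by positivity)]
  refine ENNReal.ofReal_le_ofReal ?_
  rw [inv_mul_le_iff₀ hc]
  exact_mod_cast h2

lemma randCC_le_detCC (F : (ι → X) → R → Prop) (C : Set (ι → X)) : randCC F C ≤ detCC F C := by
  refine le_iInf₂ fun P hP => ?_
  let Q : RandProtocol ι X R :=
    { Ω := Unit
      μ := MeasureTheory.Measure.dirac ()
      prot := fun _ => P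
      measurable_cost := fun x => measurable_const }
  refine (iInf₂_le Q fun ω => hP).trans (iSup₂_mono fun x hx => ?_)
  change ∫⁻ _, _ ∂(MeasureTheory.Measure.dirac ()) ≤ _
  simp [Q]

lemma randCC_mono {F' : (ι → X) → R → Prop} {C C' : Set (ι → X)} (hC : C ⊆ C')
    (hF : ∀ x ∈ C, ∀ r, F' x r → F x r) : randCC F C ≤ randCC F' C' := by
  refine le_iInf₂ fun P hP => ?_
  refine (iInf₂_le P fun ω x hx => hF x hx _ (hP ω x (hC hx))).trans ?_
  exact biSup_mono hC

end Solvable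

/-! ### Entropy lower bound for protocols -/

section Entropy

variable {ι X R : Type}

/-- Convexity of x log x at a midpoint. A bit that splits a set of inputs lowers the potential x log
(x / B) by at most the size of the set, which is what that bit costs in total over the set. -/
lemma mul_logb_add_le {a b B : ℝ} (ha : 0 ≤ a) (hb : 0 ≤ b) (hB : 0 < B) :
    (a + b) * Real.logb 2 ((a + b) / B) ≤
      a * Real.logb 2 (a / B) + b * Real.logb 2 (b / B) + (a + b) := by
  rcases eq_or_lt_of_le (add_nonneg ha hb) with h0 | hpos
  · have h1 : a = 0 := by linarith
    have h2 : b = 0 := by linarith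
    simp [h1, h2]
  obtain ⟨-, hconv⟩ := Real.convexOn_mul_log
  have h := hconv (x := a / B) (Set.mem_Ici.2 (by positivity)) (y := b / B)
    (Set.mem_Ici.2 (by positivity)) (a := 1 / 2) (b := 1 / 2) (by norm_num) (by norm_num)
    (by norm_num)
  simp only [smul_eq_mul] at h
  have e : 1 / 2 * (a / B) + 1 / 2 * (b / B) = ((a + b) / B) / 2 := by field_simp
  rw [e, Real.log_div (by positivity) (by norm_num)] at h
  have hl : 0 < Real.log 2 := Real.log_pos (by norm_num)
  simp only [Real.logb]
  set p := Real.log (a / B)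
  set q := Real.log (b / B)
  set r := Real.log ((a + b) / B)
  have h' : (a + b) * (r - Real.log 2) ≤ a * p + b * q := by
    have := mul_le_mul_of_nonneg_left h (by positivity : (0 : ℝ) ≤ 2 * B)
    have e1 : 2 * B * ((a + b) / B / 2 * (r - Real.log 2)) = (a + b) * (r - Real.log 2) := by
      field_simp
    have e2 : 2 * B * (1 / 2 * (a / B * p) + 1 / 2 * (b / B * q)) = a * p + b * q := by
      field_simp
    rwa [e1, e2] at this
  have : (a * p + b * q + (a + b) * Real.log 2) / Real.log 2 =
      a * (p / Real.log 2) + b * (q / Real.log 2) + (a + b) := by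
    field_simp
  rw [← this, ← mul_div_assoc, div_le_div_iff_of_pos_right hl]
  linarith

open Classical in
/-- If every output is acceptable for at most `B` of the inputs in `W`, then the average cost of a
correct protocol on `W` is at least `log₂ (|W| / B)`. -/
lemma Protocol.card_mul_logb_le_sum_cost {F : (ι → X) → R → Prop} {B : ℕ} (hB : 0 < B)
    (P : Protocol ι X R) (W : Finset (ι → X)) (hF : ∀ r, (W.filter fun x => F x r).card ≤ B)
    (hP : ∀ x ∈ W, F x (P.run x)) :
    (W.card : ℝ) * Real.logb 2 (W.card / B) ≤ ∑ x ∈ W, (P.cost x : ℝ) := by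
  have hB' : (0 : ℝ) < B := by exact_mod_cast hB
  induction P generalizing W with
  | output r =>
    -- At a leaf a single output serves all of `W`, so |W| ≤ B and the potential is not positive.
    have h := hF r
    rw [Finset.filter_true_of_mem (p := fun x => F x r) hP] at h
    simp only [Protocol.cost, Nat.cast_zero, Finset.sum_const_zero]
    refine mul_nonpos_of_nonneg_of_nonpos (Nat.cast_nonneg _) ?_
    refine Real.logb_nonpos (by norm_num) (by positivity) ?_
    rw [div_le_one hB']
    exact_mod_cast h
  | ask i q next ih =>
    have key : ∀ b : Bool, ((W.filter fun x => q (x i) = b).card : ℝ) *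
        Real.logb 2 ((W.filter fun x => q (x i) = b).card / B) ≤
          ∑ x ∈ W.filter (fun x => q (x i) = b), ((next b).cost x : ℝ) := by
      intro b
      refine ih b _ (fun r => ?_) fun x hx => ?_
      · refine (Finset.card_le_card ?_).trans (hF r)
        exact Finset.filter_subset_filter _ (Finset.filter_subset _ _)
      · obtain ⟨h1, h2⟩ := Finset.mem_filter.1 hx
        have := hP x h1
        rwa [Protocol.run, h2] at this
    have hsum : ∑ x ∈ W, ((Protocol.ask i q next).cost x : ℝ) =
        ∑ x ∈ W.filter (fun x => q (x i) = true), ((next true).cost x : ℝ) +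
        ∑ x ∈ W.filter (fun x => q (x i) = false), ((next false).cost x : ℝ) + W.card := by
      have e1 : ∀ b, ∑ x ∈ W.filter (fun x => q (x i) = b), ((next b).cost x : ℝ) =
          ∑ x ∈ W.filter (fun x => q (x i) = b), ((next (q (x i))).cost x : ℝ) := fun b =>
        Finset.sum_congr rfl fun x hx => by rw [(Finset.mem_filter.1 hx).2]
      rw [e1, e1]
      have := Finset.sum_filter_add_sum_filter_not W (fun x => q (x i) = true)
        (fun x => ((next (q (x i))).cost x : ℝ))
      simp only [Bool.not_eq_true] at this
      rw [this]
      simp [Protocol.cost, Finset.sum_add_distrib]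
    have hcard : (W.card : ℝ) = (W.filter fun x => q (x i) = true).card +
        (W.filter fun x => q (x i) = false).card := by
      have := Finset.card_filter_add_card_filter_not (s := W) (fun x => q (x i) = true)
      simp only [Bool.not_eq_true] at this
      exact_mod_cast this.symm
    have := mul_logb_add_le (a := (W.filter fun x => q (x i) = true).card)
      (b := (W.filter fun x => q (x i) = false).card) (Nat.cast_nonneg _) (Nat.cast_nonneg _) hB'
    rw [hsum]
    rw [← hcard] at this
    linarith [key true, key false]

-- The easy half of Yao's principle: the deterministic bound holds for the cost summed over `W`
-- under every random string, hence for its expectation, and the worst input costs at least the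
-- average one.
open Classical in
lemma le_randCC_of_card {F : (ι → X) → R → Prop} {C : Set (ι → X)} {B : ℕ} (hB : 0 < B)
    (W : Finset (ι → X)) (hW : W.Nonempty) (hWC : ∀ x ∈ W, x ∈ C)
    (hF : ∀ r, (W.filter fun x => F x r).card ≤ B) :
    ENNReal.ofReal (Real.logb 2 (W.card / B)) ≤ randCC F C := by
  refine le_iInf₂ fun P hP => ?_
  have hc0 : (W.card : ℝ≥0∞) ≠ 0 := by simpa using hW.ne_empty
  have hct : (W.card : ℝ≥0∞) ≠ ⊤ := ENNReal.natCast_ne_top _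
  have hprob := P.prob
  have h1 : (W.card : ℝ≥0∞) * ENNReal.ofReal (Real.logb 2 (W.card / B)) ≤
      ∑ x ∈ W, P.expCost x := by
    have e : ∑ x ∈ W, P.expCost x = MeasureTheory.lintegral (m := P.mΩ) P.μ
        fun ω => ∑ x ∈ W, ((P.prot ω).cost x : ℝ≥0∞) := by
      let _ := P.mΩ
      rw [MeasureTheory.lintegral_finsetSum]
      · rfl
      · intro x _
        exact (measurable_from_top (f := ((↑) : ℕ → ℝ≥0∞))).comp (P.measurable_cost x)
    rw [e]
    let _ := P.mΩ
    have : ∀ ω, (W.card : ℝ≥0∞) * ENNReal.ofReal (Real.logb 2 (W.card / B)) ≤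
        ∑ x ∈ W, ((P.prot ω).cost x : ℝ≥0∞) := by
      intro ω
      have h := (P.prot ω).card_mul_logb_le_sum_cost hB W hF fun x hx => hP ω x (hWC x hx)
      have h2 := ENNReal.ofReal_le_ofReal h
      rw [ENNReal.ofReal_mul (Nat.cast_nonneg _), ENNReal.ofReal_natCast] at h2
      refine h2.trans (le_of_eq ?_)
      rw [← Nat.cast_sum, ENNReal.ofReal_natCast, Nat.cast_sum]
    calc _ = MeasureTheory.lintegral P.μ (fun _ => (W.card : ℝ≥0∞) *
          ENNReal.ofReal (Real.logb 2 (W.card / B))) := by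
          rw [MeasureTheory.lintegral_const, MeasureTheory.measure_univ, mul_one]
      _ ≤ _ := MeasureTheory.lintegral_mono this
  have h2 : ∑ x ∈ W, P.expCost x ≤ W.card * ⨆ x ∈ C, P.expCost x := by
    rw [← nsmul_eq_mul]
    exact Finset.sum_le_card_nsmul _ _ _ fun x hx => le_iSup₂ (f := fun x _ => P.expCost x) x (hWC x hx)
  exact (ENNReal.mul_le_mul_iff_right hc0 hct).1 (h1.trans h2)

end Entropy

/-! ### Estimates for central binomial coefficients -/

section CentralBinom

/-- Induction through the ratio 2(2q + 1)/(q + 1) of consecutive central coefficients. This is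
applied to the small central coefficients, one for each bundle; the reverse estimate below is
applied to the large one that counts the instances. -/
lemma sq_centralBinom_mul_le (q : ℕ) : q.centralBinom ^ 2 * (3 * q + 1) ≤ 16 ^ q := by
  induction q with
  | zero => simp
  | succ q ih =>
    have h := Nat.succ_mul_centralBinom_succ q
    have hp : 0 < (q + 1) ^ 2 * (3 * q + 1) := by positivity
    refine Nat.le_of_mul_le_mul_left ?_ hp
    calc (q + 1) ^ 2 * (3 * q + 1) * ((q + 1).centralBinom ^ 2 * (3 * (q + 1) + 1))
        = ((q + 1) * (q + 1).centralBinom) ^ 2 * ((3 * q + 1) * (3 * q + 4)) := by ring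
      _ = (4 * (2 * q + 1) ^ 2 * (3 * q + 4)) * (q.centralBinom ^ 2 * (3 * q + 1)) := by
          rw [h]; ring
      _ ≤ (16 * (q + 1) ^ 2 * (3 * q + 1)) * 16 ^ q := by
          refine Nat.mul_le_mul ?_ ih
          nlinarith
      _ = (q + 1) ^ 2 * (3 * q + 1) * 16 ^ (q + 1) := by ring

lemma le_sq_centralBinom_mul {N : ℕ} (hN : 1 ≤ N) : 16 ^ N ≤ N.centralBinom ^ 2 * (4 * N) := by
  induction N, hN using Nat.le_induction with
  | base => simp [Nat.centralBinom, Nat.choose]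
  | succ q hq ih =>
    have h := Nat.succ_mul_centralBinom_succ q
    have hp : 0 < (q + 1) * q := by positivity
    refine Nat.le_of_mul_le_mul_left ?_ hp
    calc (q + 1) * q * 16 ^ (q + 1) = (16 * (q + 1) * q) * 16 ^ q := by ring
      _ ≤ (4 * (2 * q + 1) ^ 2) * (q.centralBinom ^ 2 * (4 * q)) := by
          refine Nat.mul_le_mul ?_ ih
          nlinarith
      _ = ((q + 1) * (q + 1).centralBinom) ^ 2 * (4 * q) := by rw [h]; ring
      _ = (q + 1) * q * ((q + 1).centralBinom ^ 2 * (4 * (q + 1))) := by ring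

lemma choose_succ_mul_sub (a q : ℕ) :
    (a + 1).choose q * (a + 1 - q) = (a + 1) * a.choose q := by
  rw [Nat.choose_mul_succ_eq a q |>.symm]; ring

/-- As a function of a, the quotient C(a,q) / 2^a is largest at a = 2q: its successive ratios (a +
1) / (2(a + 1 - q)) pass from at least 1 to at most 1 there. -/
lemma choose_mul_four_pow_le (a q : ℕ) : a.choose q * 4 ^ q ≤ q.centralBinom * 2 ^ a := by
  rcases le_total (2 * q) a with h | h
  · induction a, h using Nat.le_induction with
    | base => rw [Nat.centralBinom, pow_mul]; norm_num
    | succ a h ih =>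
      have e := choose_succ_mul_sub a q
      have : (a + 1).choose q ≤ 2 * a.choose q := by
        refine Nat.le_of_mul_le_mul_right (c := a + 1 - q) ?_ (by omega)
        rw [e]
        calc (a + 1) * a.choose q ≤ (2 * (a + 1 - q)) * a.choose q :=
              Nat.mul_le_mul_right _ (by omega)
          _ = _ := by ring
      calc _ ≤ 2 * a.choose q * 4 ^ q := Nat.mul_le_mul_right _ this
        _ ≤ 2 * (q.centralBinom * 2 ^ a) := by rw [mul_assoc]; exact Nat.mul_le_mul_left _ ih
        _ = _ := by ring
  · obtain ⟨d, hd⟩ := Nat.exists_eq_add_of_le h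
    induction d generalizing a with
    | zero => rw [Nat.add_zero] at hd; rw [← hd, Nat.centralBinom, pow_mul]; norm_num
    | succ d ih =>
      rcases lt_or_ge a q with haq | haq
      · simp [Nat.choose_eq_zero_of_lt haq]
      have ih := ih (a + 1) (by omega) (by omega)
      have e := choose_succ_mul_sub a q
      have : 2 * a.choose q ≤ (a + 1).choose q := by
        refine Nat.le_of_mul_le_mul_right (c := a + 1 - q) ?_ (by omega)
        rw [e]
        calc 2 * a.choose q * (a + 1 - q) = (2 * (a + 1 - q)) * a.choose q := by ring
          _ ≤ (a + 1) * a.choose q := Nat.mul_le_mul_right _ (by omega)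
      refine Nat.le_of_mul_le_mul_left (c := 2) ?_ (by norm_num)
      calc 2 * (a.choose q * 4 ^ q) = 2 * a.choose q * 4 ^ q := by ring
        _ ≤ (a + 1).choose q * 4 ^ q := Nat.mul_le_mul_right _ this
        _ ≤ _ := ih
        _ = _ := by ring

end CentralBinom

/-! ### Hard instances: common binary valuations -/

section Hard

/-- The number of subsets `T` of `U` with exactly `q` items from each bundle of an allocation of the
`2nq` items in `U`. -/
lemma card_balanced_le {n m q : ℕ} (U : Finset (Fin m)) (hU : U.card = 2 * (n * q))
    (A : Allocation n m) :
    (U.powerset.filter fun T => ∀ i, (T.filter fun e => A e = i).card = q).card ≤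
      q.centralBinom ^ n := by
  classical
  have h1 : (U.powerset.filter fun T => ∀ i, (T.filter fun e => A e = i).card = q).card ≤
      ∏ i : Fin n, (U.filter fun e => A e = i).card.choose q := by
    have : ∏ i : Fin n, (U.filter fun e => A e = i).card.choose q =
        (Fintype.piFinset fun i : Fin n =>
          (U.filter fun e => A e = i).powersetCard q).card := by
      simp [Fintype.card_piFinset]
    rw [this]
    refine Finset.card_le_card_of_injOn (fun T i => T.filter fun e => A e = i) ?_ ?_
    · intro T hT
      simp only [Finset.coe_filter, Finset.mem_powerset, Set.mem_ofPred_eq] at hT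
      simp only [Finset.mem_coe, Fintype.mem_piFinset, Finset.mem_powersetCard]
      exact fun i => ⟨Finset.filter_subset_filter _ hT.1, hT.2 i⟩
    · intro T _ T' _ h
      ext e
      have := congrArg (e ∈ ·) (congrFun h (A e))
      simpa using this
  -- After scaling, each factor is bounded by the central coefficient times 2 to the size of the
  -- bundle. These powers multiply to 2^|U| = 4^(nq), however the items are distributed.
  have h2 : (∏ i : Fin n, (U.filter fun e => A e = i).card.choose q) * (4 ^ q) ^ n ≤
      q.centralBinom ^ n * (4 ^ q) ^ n := by
    calc _ = ∏ i : Fin n, ((U.filter fun e => A e = i).card.choose q * 4 ^ q) := by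
          rw [Finset.prod_mul_distrib]; simp
      _ ≤ ∏ i : Fin n, (q.centralBinom * 2 ^ (U.filter fun e => A e = i).card) :=
          Finset.prod_le_prod' fun i _ => choose_mul_four_pow_le _ _
      _ = q.centralBinom ^ n * 2 ^ U.card := by
          rw [Finset.prod_mul_distrib, Finset.prod_pow_eq_pow_sum,
            ← Finset.card_eq_sum_card_fiberwise (fun e _ => Finset.mem_univ _)]
          simp
      _ = _ := by
          rw [hU, pow_mul, ← pow_mul 4, mul_comm n q]; norm_num
  exact h1.trans (Nat.le_of_mul_le_mul_right h2 (by positivity))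

/-- The binary valuation with value `1` exactly on the items of `T`. -/
def indicatorValuation {m : ℕ} (T : Finset (Fin m)) : Valuation m := fun e => if e ∈ T then 1 else 0

lemma value_indicatorValuation {m : ℕ} (T S : Finset (Fin m)) :
    (indicatorValuation T).value S = (S ∩ T).card := by
  simp only [Valuation.value, indicatorValuation]
  rw [Finset.card_eq_sum_ones, ← Finset.filter_mem_eq_inter, Finset.sum_filter]
  push_cast
  exact Finset.sum_congr rfl fun e _ => by split_ifs <;> simp

/-- The proportional share is the integer q and one more item adds at most 1, so exceeding q
strictly with one item already means at least q. As the n counts sum to nq, all of them equal q. -/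
lemma card_eq_of_prop1 {n m q : ℕ} (hn : 1 ≤ n) (T : Finset (Fin m)) (hT : T.card = n * q)
    (A : Allocation n m) (h : Prop1 (fun _ => indicatorValuation T) A) (i : Fin n) :
    (T.filter fun e => A e = i).card = q := by
  have hn' : (n : ℝ) ≠ 0 := by positivity
  have hs : propShare (indicatorValuation T) n Finset.univ = q := by
    rw [propShare, value_indicatorValuation, Finset.univ_inter, hT]
    push_cast
    field_simp
  have hb : ∀ i, A.bundle i ∩ T = T.filter fun e => A e = i := fun i => by
    ext e; simp [Allocation.bundle, and_comm]
  have hge : ∀ i, q ≤ (T.filter fun e => A e = i).card := by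
    intro i
    have := h i
    rw [hs, value_indicatorValuation, hb] at this
    rcases this with h1 | ⟨e, -, h1⟩
    · exact_mod_cast h1
    · have h2 : ((indicatorValuation T e : ℝ≥0) : ℝ) ≤ 1 := by
        unfold indicatorValuation; split_ifs <;> simp
      have h3 : (q : ℝ) < (T.filter fun e => A e = i).card + 1 := by linarith
      have : q < (T.filter fun e => A e = i).card + 1 := by exact_mod_cast h3
      omega
  have hsum : ∑ i : Fin n, q = ∑ i : Fin n, (T.filter fun e => A e = i).card := by
    rw [← Finset.card_eq_sum_card_fiberwise (fun e _ => Finset.mem_univ _), hT]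
    simp
  exact (((Finset.sum_eq_sum_iff_of_le fun i _ => hge i).1 hsum) i (Finset.mem_univ i)).symm

/-- With L = log (3q + 1), the ingredients are the two central estimates, log q ≤ L - 3/2, log n ≤ n
- 1 and L ≥ 2. Their combination leaves no slack at n = 2, q = 1, which is where the constant 1/16
comes from. -/
lemma le_logb_centralBinom {n q : ℕ} (hn : 2 ≤ n) (hq : 1 ≤ q) :
    (1 / 16 : ℝ) * (n * Real.logb 2 (3 * q + 1)) ≤
      Real.logb 2 ((n * q).centralBinom / (q.centralBinom ^ n : ℕ)) := by
  have hnR : (2 : ℝ) ≤ n := by exact_mod_cast hn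
  have hqR : (1 : ℝ) ≤ q := by exact_mod_cast hq
  have hnq : 1 ≤ n * q := Nat.one_le_iff_ne_zero.2 (by positivity)
  have c1 : (0 : ℝ) < (n * q).centralBinom := by exact_mod_cast Nat.centralBinom_pos _
  have c2 : (0 : ℝ) < q.centralBinom := by exact_mod_cast Nat.centralBinom_pos _
  have lpow : ∀ (x : ℝ) (k : ℕ), Real.logb 2 (x ^ k) = k * Real.logb 2 x := fun x k =>
    Real.logb_pow 2 x k
  have l16 : Real.logb 2 16 = 4 := by
    rw [show (16 : ℝ) = 2 ^ 4 by norm_num, lpow, Real.logb_self_eq_one (by norm_num)]; norm_num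
  have l4 : Real.logb 2 4 = 2 := by
    rw [show (4 : ℝ) = 2 ^ 2 by norm_num, lpow, Real.logb_self_eq_one (by norm_num)]; norm_num
  have l8 : Real.logb 2 8 = 3 := by
    rw [show (8 : ℝ) = 2 ^ 3 by norm_num, lpow, Real.logb_self_eq_one (by norm_num)]; norm_num
  have lmono : ∀ {x y : ℝ}, 0 < x → x ≤ y → Real.logb 2 x ≤ Real.logb 2 y := fun hx hxy =>
    Real.logb_le_logb_of_le (by norm_num) hx hxy
  have u1 : 2 * Real.logb 2 q.centralBinom + Real.logb 2 (3 * q + 1) ≤ 4 * q := by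
    have h : (q.centralBinom : ℝ) ^ 2 * (3 * q + 1) ≤ 16 ^ q := by
      exact_mod_cast sq_centralBinom_mul_le q
    have := lmono (by positivity) h
    rw [Real.logb_mul (by positivity) (by positivity), lpow, lpow, l16] at this
    push_cast at this
    linarith
  have u2 : 4 * (n * q : ℝ) ≤
      2 * Real.logb 2 (n * q).centralBinom + (2 + Real.logb 2 n + Real.logb 2 q) := by
    have h : (16 : ℝ) ^ (n * q) ≤ ((n * q).centralBinom : ℝ) ^ 2 * (4 * (n * q)) := by
      exact_mod_cast le_sq_centralBinom_mul hnq
    have := lmono (by positivity) h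
    rw [Real.logb_mul (by positivity) (by positivity), Real.logb_mul (by positivity)
      (by positivity), Real.logb_mul (by positivity) (by positivity), lpow, lpow, l16, l4] at this
    push_cast at this
    linarith
  have u3 : Real.logb 2 q + 3 / 2 ≤ Real.logb 2 (3 * q + 1) := by
    have h : 8 * (q : ℝ) ^ 2 ≤ (3 * q + 1) ^ 2 := by nlinarith
    have := lmono (by positivity) h
    rw [Real.logb_mul (by positivity) (by positivity), lpow, lpow, l8] at this
    push_cast at this
    linarith
  have u4 : (2 : ℝ) ≤ Real.logb 2 (3 * q + 1) := by
    exact l4.symm.trans_le (lmono (by norm_num) (by linarith))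
  have u5 : Real.logb 2 n ≤ n - 1 := by
    have h : (n : ℝ) ≤ 2 ^ (n - 1) := by
      have : n - 1 < 2 ^ (n - 1) := Nat.lt_two_pow_self
      exact_mod_cast (by omega : n ≤ 2 ^ (n - 1))
    have := lmono (by positivity) h
    rw [lpow, Real.logb_self_eq_one (by norm_num), Nat.cast_sub (by omega)] at this
    simpa using this
  rw [Nat.cast_pow, Real.logb_div c1.ne' (pow_pos c2 n).ne', lpow]
  set L := Real.logb 2 (3 * q + 1)
  have h6 := mul_le_mul_of_nonneg_left u1 (by positivity : (0 : ℝ) ≤ n)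
  nlinarith [mul_nonneg (sub_nonneg.2 hnR) (sub_nonneg.2 u4)]

theorem le_randCC_prop1 {n m : ℕ} (hn : 2 ≤ n) (hm : 2 * n ≤ m) :
    ENNReal.ofReal (1 / 16 * (n * Real.logb 2 (m / n))) ≤ randCC Prop1 (identicalBinary n m) := by
  classical
  -- The largest q for which 2nq items are available; it is positive because m ≥ 2n.
  set q := m / (2 * n) with hq
  have hq1 : 1 ≤ q := (Nat.one_le_div_iff (by omega)).2 hm
  have hqm : 2 * (n * q) ≤ m := by rw [← mul_assoc]; exact Nat.mul_div_le m (2 * n)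
  have hmq : m < 2 * n * (q + 1) := by
    have := Nat.lt_mul_div_succ m (show 0 < 2 * n by omega)
    exact this
  obtain ⟨U, -, hU⟩ := Finset.exists_subset_card_eq (s := (Finset.univ : Finset (Fin m)))
    (n := 2 * (n * q)) (by simpa using hqm)
  let inst : Finset (Fin m) → (Fin n → Valuation m) := fun T _ => indicatorValuation T
  have hinj : Function.Injective inst := by
    intro T T' h
    have := congrFun h ⟨0, by omega⟩
    ext e
    have := congrFun this e
    by_contra hne
    simp only [inst, indicatorValuation] at this
    split_ifs at this <;> simp_all
  set W := (U.powersetCard (n * q)).image inst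
  have hWc : W.card = (n * q).centralBinom := by
    rw [Finset.card_image_of_injective _ hinj, Finset.card_powersetCard, hU, Nat.centralBinom]
  have hB : 0 < q.centralBinom ^ n := pow_pos (Nat.centralBinom_pos q) n
  have key := le_randCC_of_card (F := Prop1) (C := identicalBinary n m) hB W ?_ ?_ ?_
  · refine le_trans (ENNReal.ofReal_le_ofReal ?_) key
    rw [hWc]
    refine le_trans ?_ (le_logb_centralBinom hn hq1)
    have hn0 : (0 : ℝ) < n := by positivity
    refine mul_le_mul_of_nonneg_left (mul_le_mul_of_nonneg_left ?_ hn0.le) (by norm_num)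
    refine Real.logb_le_logb_of_le (by norm_num) (div_pos (by exact_mod_cast (by omega)) hn0) ?_
    rw [div_le_iff₀ hn0]
    -- Since q ≥ 1, m / n < 2(q + 1) ≤ 3q + 1.
    have h1 : (m : ℝ) < 2 * n * (q + 1) := by exact_mod_cast hmq
    have h2 : (1 : ℝ) ≤ q := by exact_mod_cast hq1
    nlinarith
  · rw [← Finset.card_pos, hWc]
    exact Nat.centralBinom_pos _
  · intro x hx
    obtain ⟨T, -, rfl⟩ := Finset.mem_image.1 hx
    refine ⟨indicatorValuation T, fun e => ?_, fun _ => rfl⟩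
    unfold indicatorValuation
    split_ifs <;> simp
  · intro A
    refine le_trans ?_ (card_balanced_le U hU A)
    rw [Finset.filter_image, Finset.card_image_of_injective _ hinj]
    refine Finset.card_le_card fun T hT => ?_
    simp only [Finset.mem_filter, Finset.mem_powersetCard, Finset.mem_powerset] at hT ⊢
    exact ⟨hT.1.1, card_eq_of_prop1 (by omega) T hT.1.2 A hT.2⟩

end Hard

/-! ### Sufficient endowments, for real item values -/

section Entitled

variable {m : ℕ}

/-- With `θ = n t / (2n - 1)`: the set `S` is worth at least `(2k - 1) θ`, and it is worth at least
`k t`, or more than `k t` together with one additional item. -/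
def Entitled (n : ℕ) (u : Fin m → ℝ) (t : ℝ) (S : Finset (Fin m)) (k : ℕ) : Prop :=
  (2 * k - 1) * (n / (2 * n - 1) * t) ≤ ∑ e ∈ S, u e ∧
    (k * t ≤ ∑ e ∈ S, u e ∨ ∃ f, f ∉ S ∧ k * t < ∑ e ∈ S, u e + u f)

variable {n : ℕ} {u : Fin m → ℝ} {t : ℝ} {S A B : Finset (Fin m)} {k a b : ℕ}

lemma Entitled.mono (hu : ∀ e, 0 ≤ u e) (h : Entitled n u t A k) (hAB : A ⊆ B) :
    Entitled n u t B k := by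
  have h1 : ∑ e ∈ A, u e ≤ ∑ e ∈ B, u e :=
    Finset.sum_le_sum_of_subset_of_nonneg hAB fun e _ _ => hu e
  refine ⟨h.1.trans h1, ?_⟩
  rcases h.2 with h2 | ⟨f, hf, h2⟩
  · exact .inl (h2.trans h1)
  · by_cases hfB : f ∈ B
    · left
      have : ∑ e ∈ insert f A, u e ≤ ∑ e ∈ B, u e :=
        Finset.sum_le_sum_of_subset_of_nonneg (Finset.insert_subset hfB hAB) fun e _ _ => hu e
      rw [Finset.sum_insert hf] at this
      linarith
    · exact .inr ⟨f, hfB, by linarith⟩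

lemma threshold_eq (hn : 1 ≤ n) (t : ℝ) :
    n * t = (2 * n - 1) * (n / (2 * n - 1) * t) := by
  have : (1 : ℝ) ≤ n := by exact_mod_cast hn
  have h2 : (2 * (n : ℝ) - 1) ≠ 0 := by linarith
  rw [← mul_assoc, mul_div_assoc', mul_div_cancel_left₀ _ h2]

lemma threshold_nonneg (hn : 1 ≤ n) (ht : 0 ≤ t) : 0 ≤ n / (2 * n - 1) * t := by
  have : (1 : ℝ) ≤ n := by exact_mod_cast hn
  exact mul_nonneg (div_nonneg (by linarith) (by linarith)) ht

lemma share_eq (hn : 1 ≤ n) (t : ℝ) :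
    t = 2 * (n / (2 * n - 1) * t) - (n / (2 * n - 1) * t) / n := by
  have : (1 : ℝ) ≤ n := by exact_mod_cast hn
  have h2 : (2 * (n : ℝ) - 1) ≠ 0 := by linarith
  field_simp

lemma sum_le_card_mul (hut : ∀ e, u e ≤ t) {c : ℕ} (hc : A.card ≤ c) (ht : 0 ≤ t) :
    ∑ e ∈ A, u e ≤ c * t := by
  refine (Finset.sum_le_card_nsmul A u t fun e _ => hut e).trans ?_
  rw [nsmul_eq_mul]
  exact mul_le_mul_of_nonneg_right (by exact_mod_cast hc) ht

/-- Giving away items worth at most `a` shares. -/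
lemma Entitled.of_le (hn : 1 ≤ n) (ht : 0 ≤ t) (h : Entitled n u t S (a + b))
    (hA : ∑ e ∈ A, u e ≤ a * t)
    (hS : ∑ e ∈ S, u e = ∑ e ∈ A, u e + ∑ e ∈ B, u e) (hBS : B ⊆ S) :
    Entitled n u t B b := by
  have h1 := share_eq hn t
  have hθ := threshold_nonneg hn ht
  obtain ⟨g1, g2⟩ := h
  push_cast at g1 g2
  set θ := n / (2 * n - 1) * t
  have h3 : t ≤ 2 * θ := by
    have : 0 ≤ θ / n := by positivity
    linarith
  refine ⟨?_, ?_⟩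
  · have : (a : ℝ) * t ≤ a * (2 * θ) := mul_le_mul_of_nonneg_left h3 (Nat.cast_nonneg a)
    linarith
  · rcases g2 with g2 | ⟨f, hf, g2⟩
    · exact .inl (by linarith)
    · exact .inr ⟨f, fun h => hf (hBS h), by linarith⟩

/-- Cutting the items `S` of `a + b` agents in front of a small item `p`: if the items `A` before
the cut do not suffice for `a` agents, then the items `B` behind `p` suffice for `b` agents. -/
lemma Entitled.of_not_entitled (hn : 1 ≤ n) (ht : 0 ≤ t) (hab : a ≤ b)
    (h : Entitled n u t S (a + b)) (hA : ¬ Entitled n u t A a) {p : Fin m} (hpA : p ∉ A)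
    (hpB : p ∉ B) (hp : u p < n / (2 * n - 1) * t)
    (hS : ∑ e ∈ S, u e = ∑ e ∈ A, u e + u p + ∑ e ∈ B, u e) (hBS : B ⊆ S) :
    Entitled n u t B b := by
  classical
  by_cases hle : ∑ e ∈ insert p A, u e ≤ a * t
  · refine h.of_le hn ht hle ?_ hBS
    rw [Finset.sum_insert hpA, hS]; ring
  rw [Finset.sum_insert hpA] at hle
  push Not at hle
  -- `A` together with `p` exceeds `a` shares, so `A` can only fail by being worth too little. That
  -- leaves `B` and `p` together more than 2bθ, and `B` alone more than (2b - 1) θ.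
  have hlt : ∑ e ∈ A, u e < (2 * a - 1) * (n / (2 * n - 1) * t) := by
    by_contra hge
    push Not at hge
    exact hA ⟨hge, .inr ⟨p, hpA, by linarith⟩⟩
  have h1 := share_eq hn t
  have hθ := threshold_nonneg hn ht
  obtain ⟨g1, -⟩ := h
  push_cast at g1
  set θ := n / (2 * n - 1) * t
  have h5 : (a : ℝ) * (θ / n) ≤ b * (θ / n) :=
    mul_le_mul_of_nonneg_right (by exact_mod_cast hab) (by positivity)
  have e1 : (a : ℝ) * t = 2 * a * θ - a * (θ / n) := by rw [h1]; ring
  have e2 : (b : ℝ) * t = 2 * b * θ - b * (θ / n) := by rw [h1]; ring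
  exact ⟨by linarith, .inr ⟨p, hpB, by linarith⟩⟩

lemma Entitled.of_share_eq_zero (hu : ∀ e, 0 ≤ u e) (B : Finset (Fin m)) :
    Entitled n u 0 B k := by
  have := Finset.sum_nonneg (s := B) fun e _ => hu e
  exact ⟨by simpa using this, .inl (by simpa using this)⟩

/-- Two big items: each of them suffices. -/
lemma Entitled.singleton_of_two (hn : 1 ≤ n) (ht : 0 < t) {e f : Fin m} (hne : f ≠ e)
    (he : n / (2 * n - 1) * t ≤ u e) (hf : n / (2 * n - 1) * t ≤ u f) :
    Entitled n u t {e} 1 := by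
  have h1 := share_eq hn t
  have hn' : (1 : ℝ) ≤ n := by exact_mod_cast hn
  have hθ : 0 < n / (2 * n - 1) * t := mul_pos (div_pos (by linarith) (by linarith)) ht
  set θ := n / (2 * n - 1) * t
  have : 0 < θ / n := by positivity
  refine ⟨?_, .inr ⟨f, by simpa using hne, ?_⟩⟩
  · simp only [Nat.cast_one, Finset.sum_singleton]; linarith
  · simp only [Nat.cast_one, Finset.sum_singleton]; linarith

end Entitled

/-! ### Truncated values and sufficiency -/

section Truncated

variable {m n : ℕ}

/-- The values of the items, truncated at the truncated proportional share. -/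
noncomputable def truncValue (n : ℕ) (v : Valuation m) (e : Fin m) : ℝ := min (v e) (tps v n Finset.univ)

lemma tps_nonneg (v : Valuation m) (n : ℕ) (S : Finset (Fin m)) : 0 ≤ tps v n S := by
  induction n generalizing S with
  | zero => simp [tps]
  | succ n ih =>
    rw [tps]
    split_ifs with h
    · exact ih _
    · exact div_nonneg (Finset.sum_nonneg fun e _ => NNReal.coe_nonneg _) (Nat.cast_nonneg _)

/-- Removing an over-proportional item does not raise the share of the others. Hence every removed
item is worth at least the final truncated share, and after truncation contributes exactly that
share, in step with the agent removed with it. The two claims feed each other in the induction. -/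
lemma mul_tps_le (v : Valuation m) (n : ℕ) (S : Finset (Fin m)) :
    n * tps v n S ≤ ∑ e ∈ S, min (v e : ℝ) (tps v n S) ∧ (1 ≤ n → tps v n S ≤ propShare v n S) := by
  classical
  induction n generalizing S with
  | zero =>
    simp only [tps, Nat.cast_zero, zero_mul]
    exact ⟨Finset.sum_nonneg fun e _ => le_min (NNReal.coe_nonneg _) le_rfl, by omega⟩
  | succ n ih =>
    rw [tps]
    split_ifs with h
    · obtain ⟨he, hlt⟩ := h.choose_spec
      set e := h.choose
      obtain ⟨h1, h2⟩ := ih (S.erase e)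
      set t := tps v n (S.erase e)
      have hv : v.value S = v e + v.value (S.erase e) := (Finset.add_sum_erase S _ he).symm
      have hv0 : 0 ≤ v.value (S.erase e) := Finset.sum_nonneg fun e _ => NNReal.coe_nonneg _
      have hle : t ≤ propShare v (n + 1) S := by
        rcases Nat.eq_zero_or_pos n with h0 | hpos
        · have : t = 0 := by simp only [t, h0, tps]
          rw [this]
          exact div_nonneg (Finset.sum_nonneg fun e _ => NNReal.coe_nonneg _) (Nat.cast_nonneg _)
        · refine (h2 hpos).trans ?_
          have hn : (0 : ℝ) < n := by exact_mod_cast hpos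
          unfold propShare at hlt ⊢
          push_cast at hlt ⊢
          rw [div_lt_iff₀ (by positivity), hv] at hlt
          rw [div_le_div_iff₀ hn (by positivity), hv]
          nlinarith
      refine ⟨?_, fun _ => hle⟩
      rw [← Finset.add_sum_erase S _ he, min_eq_right (hle.trans hlt.le)]
      push_cast
      linarith
    · push Not at h
      refine ⟨?_, fun _ => le_rfl⟩
      rw [Finset.sum_congr rfl fun e he => min_eq_left (h e he)]
      unfold propShare Valuation.value
      push_cast
      field_simp
      exact le_rfl

lemma tps_eq_propShare {v : Valuation m} (hn : 1 ≤ n)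
    (h : ∀ e, (v e : ℝ) ≤ propShare v n Finset.univ) :
    tps v n Finset.univ = propShare v n Finset.univ := by
  obtain ⟨n, rfl⟩ := Nat.exists_eq_add_of_le' hn
  rw [tps, dif_neg]
  push Not
  exact fun e _ => h e

lemma truncValue_nonneg (n : ℕ) (v : Valuation m) (e : Fin m) : 0 ≤ truncValue n v e :=
  le_min (NNReal.coe_nonneg _) (tps_nonneg _ _ _)

lemma truncValue_le (n : ℕ) (v : Valuation m) (e : Fin m) :
    truncValue n v e ≤ tps v n Finset.univ := min_le_right _ _

/-- `S` is a sufficient endowment for `k` agents, in the eyes of an agent with valuation `v`. -/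
def Suffices (n : ℕ) (v : Valuation m) (S : Finset (Fin m)) (k : ℕ) : Prop :=
  Entitled n (truncValue n v) (tps v n Finset.univ) S k

/-- An item that is worth a `n / (2n - 1)` fraction of the truncated proportional share. -/
def IsBig (n : ℕ) (v : Valuation m) (e : Fin m) : Prop :=
  n / (2 * n - 1) * tps v n Finset.univ ≤ truncValue n v e ∧ 0 < tps v n Finset.univ

lemma Suffices.mono {v : Valuation m} {A B : Finset (Fin m)} {k : ℕ} (h : Suffices n v A k)
    (hAB : A ⊆ B) : Suffices n v B k :=
  Entitled.mono (truncValue_nonneg n v) h hAB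

lemma suffices_univ (hn : 1 ≤ n) (v : Valuation m) : Suffices n v Finset.univ n := by
  have h := (mul_tps_le v n Finset.univ).1
  exact ⟨by rw [← threshold_eq hn]; exact h, .inl h⟩

/-- Truncation makes every item worth at most one share, so at most `a` items are worth at most `a`
shares. -/
lemma Suffices.of_card {v : Valuation m} {S A B : Finset (Fin m)} {a b : ℕ} (hn : 1 ≤ n)
    (h : Suffices n v S (a + b)) (hA : A.card ≤ a) (hBS : B ⊆ S) (hS : S ⊆ A ∪ B) :
    Suffices n v B b := by
  classical
  have hA' : (S \ B).card ≤ a := (Finset.card_le_card fun e he => by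
    have := hS (Finset.sdiff_subset he)
    simp_all).trans hA
  refine Entitled.of_le hn (tps_nonneg _ _ _) h (A := S \ B)
    (sum_le_card_mul (truncValue_le n v) hA' (tps_nonneg _ _ _)) ?_ hBS
  exact (Finset.sum_sdiff hBS).symm

lemma Suffices.of_not_suffices {v : Valuation m} {S A B : Finset (Fin m)} {a b : ℕ} (hn : 1 ≤ n)
    (hab : a ≤ b) (h : Suffices n v S (a + b)) (hA : ¬ Suffices n v A a) {p : Fin m} (hpA : p ∉ A)
    (hpB : p ∉ B) (hp : ¬ IsBig n v p) (hAB : Disjoint A B) (hBS : B ⊆ S)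
    (hS : S = insert p A ∪ B) : Suffices n v B b := by
  classical
  rcases (tps_nonneg v n Finset.univ).eq_or_lt with ht | ht
  · unfold Suffices
    rw [← ht]
    exact Entitled.of_share_eq_zero (truncValue_nonneg n v) B
  · have hp' : truncValue n v p < n / (2 * n - 1) * tps v n Finset.univ := by
      by_contra hge
      exact hp ⟨not_lt.1 hge, ht⟩
    refine Entitled.of_not_entitled hn ht.le hab h hA hpA hpB hp' ?_ hBS
    rw [hS, Finset.sum_union, Finset.sum_insert hpA, add_comm (truncValue n v p)]
    exact Finset.disjoint_insert_left.2 ⟨hpB, hAB⟩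

lemma eq_of_isBig {v : Valuation m} (hn : 1 ≤ n) {e f : Fin m} (he : IsBig n v e)
    (hf : IsBig n v f) (h : ¬ Suffices n v {e} 1) : f = e := by
  by_contra hne
  exact h (Entitled.singleton_of_two hn he.2 hne he.1 hf.1)

/-- An allocation in which the bundle of each agent is sufficient for one agent is an `Aprop`
allocation. -/
lemma aprop_of_suffices (hn : 1 ≤ n) {v : Fin n → Valuation m} {A : Allocation n m}
    (h : ∀ i, Suffices n (v i) (A.bundle i) 1) : Aprop v A := by
  classical
  have hle : ∀ i, ∑ e ∈ A.bundle i, truncValue n (v i) e ≤ (v i).value (A.bundle i) := fun i =>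
    Finset.sum_le_sum fun e _ => min_le_left _ _
  refine ⟨fun i => ?_, fun i => ?_⟩
  -- An over-proportional item makes Prop1 automatic, whether the agent owns it or adds it. If there
  -- is none, the truncated share is the proportional share.
  · by_cases hov : ∃ e, propShare (v i) n Finset.univ < v i e
    · obtain ⟨e, he⟩ := hov
      by_cases heA : e ∈ A.bundle i
      · left
        refine he.le.trans ?_
        exact Finset.single_le_sum (f := fun e => ((v i e : ℝ≥0) : ℝ))
          (fun e _ => NNReal.coe_nonneg _) heA
      · refine .inr ⟨e, heA, ?_⟩
        have : 0 ≤ (v i).value (A.bundle i) := Finset.sum_nonneg fun e _ => NNReal.coe_nonneg _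
        linarith
    · push Not at hov
      have ht := tps_eq_propShare hn hov
      rcases (h i).2 with h2 | ⟨f, hf, h2⟩
      · left
        rw [ht, Nat.cast_one, one_mul] at h2
        exact h2.trans (hle i)
      · refine .inr ⟨f, hf, ?_⟩
        rw [ht, Nat.cast_one, one_mul] at h2
        have : truncValue n (v i) f ≤ v i f := min_le_left _ _
        linarith [hle i]
  · have := (h i).1
    refine le_trans (le_of_eq ?_) (this.trans (hle i))
    push_cast
    ring

end Truncated

/-! ### Selecting the agents with the lowest keys -/

section Selection

variable {n : ℕ} {X R : Type} {rand : Prop}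

/-- Each agent in `G` answers a question. -/
lemma Solvable.askAll {α : Type} [Fintype α] [Nonempty α] (f : Fin n → X → α) {d : ℕ}
    (hd : Fintype.card α ≤ 2 ^ d) (G : Finset (Fin n)) :
    Solvable rand (Set.univ : Set (Fin n → X))
      (fun x (r : Fin n → α) => ∀ j ∈ G, r j = f j (x j)) (fun _ => G.card * d) := by
  classical
  induction G using Finset.induction_on with
  | empty => exact Solvable.pure (fun _ => Classical.arbitrary α) (by simp) (by simp)
  | insert i G hi ih =>
    refine (ih.bind (β₂ := fun _ => d) (F := fun x (r : Fin n → α) => ∀ j ∈ insert i G,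
      r j = f j (x j)) fun r => ?_).mono subset_rfl (fun _ _ _ h => h) (fun x _ => ?_)
    · refine ((Solvable.ask i (f i) hd).mono (Set.subset_univ _) (fun _ _ _ h => h)
        (fun _ _ => le_rfl)).map (fun a => Function.update r i a) ?_
      rintro x ⟨-, hx⟩ a rfl j hj
      rcases Finset.mem_insert.1 hj with rfl | hj
      · simp
      · rw [Function.update_of_ne (ne_of_mem_of_not_mem hj hi)]
        exact hx j hj
    · rw [Finset.card_insert_of_notMem hi]
      push_cast
      linarith

/-- `o.2` consists of `a` agents in `G` whose keys are at most `o.1`, and all other agents in `G`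
have keys at least `o.1`. -/
def IsSplit {N : ℕ} (key : Fin n → Fin N) (G : Finset (Fin n)) (a : ℕ)
    (o : Fin N × Finset (Fin n)) : Prop :=
  o.2 ⊆ G ∧ o.2.card = a ∧ (∀ j ∈ o.2, key j ≤ o.1) ∧ ∀ j ∈ G, j ∉ o.2 → o.1 ≤ key j

lemma exists_isSplit {N : ℕ} (key : Fin n → Fin N) (G : Finset (Fin n)) {a : ℕ} (ha : 1 ≤ a)
    (haG : a ≤ G.card) : ∃ o, IsSplit key G a o := by
  classical
  obtain ⟨j, hj⟩ : G.Nonempty := Finset.card_pos.1 (by omega)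
  have hne : (Finset.univ.filter fun c => a ≤ (G.filter fun j => key j ≤ c).card).Nonempty := by
    have : Nonempty (Fin N) := ⟨key j⟩
    obtain ⟨c, hc⟩ := Finite.exists_max (fun c : Fin N => c)
    refine ⟨c, ?_⟩
    rw [Finset.mem_filter, Finset.filter_true_of_mem fun j _ => hc (key j)]
    exact ⟨Finset.mem_univ _, haG⟩
  -- The threshold is the least value that at least `a` keys do not exceed. At most `a` keys lie
  -- strictly below it, and ties at the threshold fill the set up to `a`.
  set c := Finset.min' _ hne
  have hc : a ≤ (G.filter fun j => key j ≤ c).card :=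
    (Finset.mem_filter.1 (Finset.min'_mem _ hne)).2
  have hlt : (G.filter fun j => key j < c).card ≤ a := by
    by_contra hcon
    push Not at hcon
    have hne2 : (G.filter fun j => key j < c).Nonempty := Finset.card_pos.1 (by omega)
    obtain ⟨i, hi, hmax⟩ := Finset.exists_max_image _ key hne2
    have : c ≤ key i := Finset.min'_le _ _ (by
      rw [Finset.mem_filter]
      refine ⟨Finset.mem_univ _, hcon.le.trans (Finset.card_le_card fun j hj => ?_)⟩
      exact Finset.mem_filter.2 ⟨(Finset.mem_filter.1 hj).1, hmax j hj⟩)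
    exact absurd (Finset.mem_filter.1 hi).2 (not_lt.2 this)
  obtain ⟨L, h1, h2, h3⟩ := Finset.exists_subsuperset_card_eq
    (Finset.monotone_filter_right G fun j _ (h : key j < c) => h.le) hlt hc
  refine ⟨(c, L), fun j hj => (Finset.mem_filter.1 (h2 hj)).1, h3,
    fun j hj => (Finset.mem_filter.1 (h2 hj)).2, fun j hj hjL => ?_⟩
  by_contra hcon
  exact hjL (h1 (Finset.mem_filter.2 ⟨hj, not_le.1 hcon⟩))

/-- The deterministic selection: everybody reports her key. -/
lemma Solvable.select_of_askAll {N d : ℕ} (hN : 0 < N) (hd : N ≤ 2 ^ d) (key : Fin n → X → Fin N)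
    (G : Finset (Fin n)) {a : ℕ} (ha : 1 ≤ a) (haG : a ≤ G.card) :
    Solvable rand (Set.univ : Set (Fin n → X))
      (fun x => IsSplit (fun j => key j (x j)) G a) (fun _ => G.card * d) := by
  classical
  have : Nonempty (Fin N) := ⟨⟨0, hN⟩⟩
  refine (Solvable.askAll key (by simpa using hd) G).map
    (fun r => Classical.choose (exists_isSplit r G ha haG)) ?_
  rintro x - r hr
  obtain ⟨h1, h2, h3, h4⟩ := Classical.choose_spec (exists_isSplit r G ha haG)
  exact ⟨h1, h2, fun j hj => (hr j (h1 hj)).symm.trans_le (h3 j hj),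
    fun j hj hjL => (h4 j hj hjL).trans_eq (hr j hj)⟩

/-- From k to k + 2, two extreme ranks are added and the maxima of the inner ranks grow by one. -/
lemma sum_max_le (k : ℕ) : 4 * ∑ ρ ∈ Finset.range k, max ρ (k - 1 - ρ) ≤ 3 * k ^ 2 := by
  induction k using Nat.twoStepInduction with
  | zero => simp
  | one => simp
  | more k ih _ =>
    rw [Finset.sum_range_succ, Finset.sum_range_succ']
    have : ∀ ρ ∈ Finset.range k, max (ρ + 1) (k + 2 - 1 - (ρ + 1)) = max ρ (k - 1 - ρ) + 1 := by
      intro ρ hρ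
      have := Finset.mem_range.1 hρ
      omega
    rw [Finset.sum_congr rfl this, Finset.sum_add_distrib]
    simp only [Finset.sum_const, Finset.card_range, smul_eq_mul, mul_one]
    have e1 : max 0 (k + 2 - 1 - 0) = k + 1 := by omega
    have e2 : max (k + 1) (k + 2 - 1 - (k + 1)) = k + 1 := by omega
    rw [e1, e2]
    nlinarith

/-- The bound for the expected cost of the selection among `k` agents with keys of `d` bits. -/
noncomputable def selectCost (d k : ℕ) : ℝ := 5 * k + 10 * (d * √k)

lemma selectCost_mono (d : ℕ) {k l : ℕ} (h : k ≤ l) : selectCost d k ≤ selectCost d l := by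
  have h' : (k : ℝ) ≤ l := by exact_mod_cast h
  have := Real.sqrt_le_sqrt h'
  unfold selectCost
  gcongr

lemma selectCost_nonneg (d k : ℕ) : 0 ≤ selectCost d k := by
  unfold selectCost; positivity

/-- The larger side of a random pivot has average size at most 3k/4, and by Cauchy–Schwarz its
square root averages at most 0.87 √k. The constants 5 and 10 close the recursion: 1 + 5 · 3/4 ≤ 5
and 1 + 10 · 0.87 ≤ 10. -/
lemma average_selectCost_le (d : ℕ) {k : ℕ} (hk : 1 ≤ k) :
    (∑ ρ ∈ Finset.range k, (d + k + selectCost d (max ρ (k - 1 - ρ)))) / k ≤ selectCost d k := by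
  have hk' : (1 : ℝ) ≤ k := by exact_mod_cast hk
  have hs : 1 ≤ √(k : ℝ) := Real.one_le_sqrt.2 hk'
  have hss : √(k : ℝ) ^ 2 = k := Real.sq_sqrt (by linarith)
  have h1 : ∑ ρ ∈ Finset.range k, ((max ρ (k - 1 - ρ) : ℕ) : ℝ) ≤ 3 / 4 * k ^ 2 := by
    have : (4 * ∑ ρ ∈ Finset.range k, ((max ρ (k - 1 - ρ) : ℕ) : ℝ)) ≤ 3 * k ^ 2 := by
      exact_mod_cast sum_max_le k
    linarith
  have h2 : ∑ ρ ∈ Finset.range k, √((max ρ (k - 1 - ρ) : ℕ) : ℝ) ≤ 0.87 * (k * √k) := by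
    refine (pow_le_pow_iff_left₀ (Finset.sum_nonneg fun _ _ => Real.sqrt_nonneg _)
      (by positivity) two_ne_zero).1 ?_
    refine (sq_sum_le_card_mul_sum_sq).trans ?_
    rw [Finset.card_range, Finset.sum_congr rfl fun ρ _ =>
      Real.sq_sqrt (Nat.cast_nonneg (max ρ (k - 1 - ρ)))]
    calc _ ≤ (k : ℝ) * (3 / 4 * k ^ 2) := mul_le_mul_of_nonneg_left h1 (by linarith)
      _ ≤ 0.87 ^ 2 * k ^ 2 * k := by nlinarith [pow_pos (by linarith : (0 : ℝ) < k) 3]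
      _ = _ := by rw [mul_pow, mul_pow, hss]; ring
  rw [div_le_iff₀ (by linarith)]
  unfold selectCost
  simp only [Finset.sum_add_distrib, ← Finset.mul_sum, Finset.sum_const, Finset.card_range,
    nsmul_eq_mul]
  have h3 := mul_le_mul_of_nonneg_left h2 (Nat.cast_nonneg (α := ℝ) d)
  have h4 : (d : ℝ) * k ≤ d * (k * √k) :=
    mul_le_mul_of_nonneg_left (le_mul_of_one_le_right (by linarith) hs) (Nat.cast_nonneg d)
  nlinarith [mul_nonneg (Nat.cast_nonneg (α := ℝ) d) (mul_nonneg (by linarith : (0 : ℝ) ≤ k) (by linarith : 0 ≤ √(k : ℝ)))]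

/-- The candidates in `K` that precede `i`, with ties broken by the names of the agents. -/
def preceding {N : ℕ} (key : Fin n → Fin N) (K : Finset (Fin n)) (i : Fin n) : Finset (Fin n) :=
  K.filter fun j => key j < key i ∨ key j = key i ∧ j < i

/-- With ties broken by names the order is strict, so the ranks of the candidates run through 0, …,
|K| - 1 once each; a uniform pivot has uniform rank on every input. -/
lemma sum_card_preceding {N : ℕ} (key : Fin n → Fin N) (K : Finset (Fin n)) (g : ℕ → ℝ) :
    ∑ i ∈ K, g (preceding key K i).card = ∑ ρ ∈ Finset.range K.card, g ρ := by
  classical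
  have hss : ∀ i ∈ K, ∀ j ∈ K, (key i < key j ∨ key i = key j ∧ i < j) →
      (preceding key K i).card < (preceding key K j).card := by
    intro i hi j hj hij
    refine Finset.card_lt_card (Finset.ssubset_iff_of_subset ?_ |>.2 ⟨i, ?_, ?_⟩)
    · intro l hl
      simp only [preceding, Finset.mem_filter] at hl ⊢
      refine ⟨hl.1, ?_⟩
      rcases hl.2 with h | ⟨h, h'⟩ <;> rcases hij with g | ⟨g, g'⟩
      · exact .inl (h.trans g)
      · exact .inl (g ▸ h)
      · exact .inl (h ▸ g)
      · exact .inr ⟨h.trans g, h'.trans g'⟩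
    · simp [preceding, hi, hij]
    · simp [preceding]
  have hinj : Set.InjOn (fun i => (preceding key K i).card) K := by
    intro i hi j hj h
    rcases lt_trichotomy (key i) (key j) with h1 | h1 | h1
    · exact absurd h (hss i hi j hj (.inl h1)).ne
    · rcases lt_trichotomy i j with h2 | h2 | h2
      · exact absurd h (hss i hi j hj (.inr ⟨h1, h2⟩)).ne
      · exact h2
      · exact absurd h (hss j hj i hi (.inr ⟨h1.symm, h2⟩)).ne'
    · exact absurd h (hss j hj i hi (.inl h1)).ne'
  have himg : K.image (fun i => (preceding key K i).card) = Finset.range K.card := by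
    refine Finset.eq_of_subset_of_card_le (fun ρ hρ => ?_) ?_
    · obtain ⟨i, hi, rfl⟩ := Finset.mem_image.1 hρ
      refine Finset.mem_range.2 (Finset.card_lt_card (Finset.ssubset_iff_of_subset
        (Finset.filter_subset _ _) |>.2 ⟨i, hi, by simp⟩))
    · rw [Finset.card_image_of_injOn hinj, Finset.card_range]
  rw [← himg, Finset.sum_image hinj]

/-- Selection with random pivots. -/
lemma Solvable.quickselect {N d : ℕ} (hN : 0 < N) (hd : N ≤ 2 ^ d) (key : Fin n → X → Fin N)
    (K : Finset (Fin n)) {r : ℕ} (hr : r < K.card) :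
    Solvable True (Set.univ : Set (Fin n → X))
      (fun x o => IsSplit (fun j => key j (x j)) K r o ∧ ∃ j ∈ K, j ∉ o.2 ∧ key j (x j) = o.1)
      (fun _ => selectCost d K.card) := by
  classical
  induction hk : K.card using Nat.strong_induction_on generalizing K r with
  | _ k ih =>
  have hne : Nonempty (Fin N) := ⟨⟨0, hN⟩⟩
  have hKne : Nonempty K := (Finset.card_pos.1 (by omega)).to_subtype
  -- For a fixed pivot: she sends her key with `d` bits, everybody in `K` sends one bit of
  -- comparison, and the search continues on one side of her.
  have hpiv : ∀ i : K, Solvable True (Set.univ : Set (Fin n → X))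
      (fun x o => IsSplit (fun j => key j (x j)) K r o ∧ ∃ j ∈ K, j ∉ o.2 ∧ key j (x j) = o.1)
      (fun x => d + (k + selectCost d (max (preceding (fun j => key j (x j)) K i).card
        (k - 1 - (preceding (fun j => key j (x j)) K i).card)))) := by
    rintro ⟨i, hi⟩
    refine (Solvable.ask i (key i) (by simpa using hd)).bind
      (β₂ := fun x => k + selectCost d (max (preceding (fun j => key j (x j)) K i).card
        (k - 1 - (preceding (fun j => key j (x j)) K i).card))) fun c => ?_
    have hbits := (Solvable.askAll (rand := True) (α := Bool)
      (fun j y => decide (key j y < c ∨ key j y = c ∧ j < i)) (d := 1) (by simp) K).mono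
      (S' := {x | x ∈ Set.univ ∧ c = key i (x i)}) (β' := fun _ => (k : ℝ))
      (Set.subset_univ _) (fun _ _ _ h => h) (fun _ _ => by simp [hk])
    refine hbits.bind fun b => ?_
    set B := K.filter fun j => b j = true with hB
    have hBp : ∀ x : Fin n → X, c = key i (x i) →
        (∀ j ∈ K, b j = decide (key j (x j) < c ∨ key j (x j) = c ∧ j < i)) →
        preceding (fun j => key j (x j)) K i = B := by
      intro x hc hb
      rw [hB, preceding]
      refine Finset.filter_congr fun j hj => ?_
      rw [hb j hj, hc]
      simp
    have hBi : ∀ x : Fin n → X, c = key i (x i) →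
        (∀ j ∈ K, b j = decide (key j (x j) < c ∨ key j (x j) = c ∧ j < i)) → i ∉ B := by
      intro x hc hb
      rw [← hBp x hc hb]
      simp [preceding]
    have hlow : ∀ x : Fin n → X, c = key i (x i) →
        (∀ j ∈ K, b j = decide (key j (x j) < c ∨ key j (x j) = c ∧ j < i)) →
        (∀ j ∈ B, key j (x j) ≤ c) ∧ ∀ j ∈ K, j ∉ B → c ≤ key j (x j) := by
      intro x hc hb
      refine ⟨fun j hj => ?_, fun j hj hjB => ?_⟩
      · have h1 := (Finset.mem_filter.1 hj).2
        rw [hb j (Finset.mem_filter.1 hj).1, decide_eq_true_iff] at h1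
        rcases h1 with h | h
        · exact h.le
        · exact h.1.le
      · by_contra hcon
        refine hjB (Finset.mem_filter.2 ⟨hj, ?_⟩)
        rw [hb j hj, decide_eq_true_iff]
        exact .inl (not_le.1 hcon)
    have hBK : B ⊆ K := Finset.filter_subset _ _
    rcases lt_trichotomy B.card r with hlt | heq | hgt
    · by_cases hiB : i ∈ B
      · refine Solvable.pure (c, ∅) ?_ ?_ <;> rintro x ⟨⟨-, hc⟩, hb⟩ <;>
          exact absurd hiB (hBi x hc hb)
      have hcard : (K \ insert i B).card = k - 1 - B.card := by
        rw [Finset.card_sdiff_of_subset (Finset.insert_subset hi hBK),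
          Finset.card_insert_of_notMem hiB, hk]
        omega
      refine ((ih _ (by rw [← hcard]; omega) (K \ insert i B) (r := r - B.card - 1)
        (by omega) hcard).mono (Set.subset_univ _) (fun _ _ _ h => h) ?_).map
        (fun o => (o.1, insert i B ∪ o.2)) ?_
      · rintro x ⟨⟨-, hc⟩, hb⟩
        rw [hBp x hc hb]
        exact selectCost_mono d (le_max_right _ _)
      · rintro x ⟨⟨-, hc⟩, hb⟩ ⟨c', L⟩ ⟨⟨h1, h2, h3, h4⟩, j, hj, hjL, hjc⟩
        simp only at h1 h2 h3 h4 hjL hjc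
        obtain ⟨l1, l2⟩ := hlow x hc hb
        have hjK := Finset.mem_sdiff.1 hj
        -- The recursive threshold is the key of a candidate beyond the pivot, so it is at least the
        -- pivot's key. The statement carries this witness for the sake of such comparisons.
        have hcc : c ≤ c' := hjc ▸ l2 j hjK.1 fun h => hjK.2 (Finset.mem_insert_of_mem h)
        refine ⟨⟨?_, ?_, ?_, ?_⟩, j, hjK.1, ?_, hjc⟩
        · exact Finset.union_subset (Finset.insert_subset hi hBK)
            (h1.trans Finset.sdiff_subset)
        · rw [Finset.card_union_of_disjoint, Finset.card_insert_of_notMem hiB, h2]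
          · omega
          · exact Finset.disjoint_left.2 fun e he heL => (Finset.mem_sdiff.1 (h1 heL)).2 he
        · intro l hl
          rcases Finset.mem_union.1 hl with hl | hl
          · rcases Finset.mem_insert.1 hl with rfl | hl
            · exact hc.symm.trans_le hcc
            · exact (l1 l hl).trans hcc
          · exact h3 l hl
        · intro l hl hln
          rw [Finset.mem_union, not_or] at hln
          exact h4 l (Finset.mem_sdiff.2 ⟨hl, hln.1⟩) hln.2
        · rw [Finset.mem_union, not_or]
          exact ⟨hjK.2, hjL⟩
    · refine Solvable.pure (c, B) ?_ fun x _ => selectCost_nonneg _ _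
      rintro x ⟨⟨-, hc⟩, hb⟩
      obtain ⟨l1, l2⟩ := hlow x hc hb
      exact ⟨⟨hBK, heq, l1, l2⟩, i, hi, hBi x hc hb, hc.symm⟩
    · by_cases hiB : i ∈ B
      · refine Solvable.pure (c, ∅) ?_ ?_ <;> rintro x ⟨⟨-, hc⟩, hb⟩ <;>
          exact absurd hiB (hBi x hc hb)
      have hBlt : B.card < k := hk ▸ Finset.card_lt_card
        (Finset.ssubset_iff_of_subset hBK |>.2 ⟨i, hi, hiB⟩)
      refine (ih _ hBlt B hgt rfl).mono (Set.subset_univ _) ?_ ?_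
      · rintro x ⟨⟨-, hc⟩, hb⟩ ⟨c', L⟩ ⟨⟨h1, h2, h3, h4⟩, j, hj, hjL, hjc⟩
        simp only at h1 h2 h3 h4 hjL hjc
        obtain ⟨l1, l2⟩ := hlow x hc hb
        refine ⟨⟨h1.trans hBK, h2, h3, fun l hl hlL => ?_⟩, j, hBK hj, hjL, hjc⟩
        by_cases hlB : l ∈ B
        · exact h4 l hlB hlL
        · exact (hjc ▸ l1 j hj).trans (l2 l hl hlB)
      · rintro x ⟨⟨-, hc⟩, hb⟩
        rw [hBp x hc hb]
        exact selectCost_mono d (le_max_left _ _)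
  refine (Solvable.flip hpiv).mono subset_rfl (fun _ _ _ h => h) fun x _ => ?_
  refine le_trans (le_of_eq ?_) (average_selectCost_le d (k := k) (by omega))
  rw [Fintype.card_coe, hk, Finset.univ_eq_attach,
    Finset.sum_attach K fun i => (d : ℝ) + (k + selectCost d
      (max (preceding (fun j => key j (x j)) K i).card
        (k - 1 - (preceding (fun j => key j (x j)) K i).card))),
    sum_card_preceding (fun j => key j (x j)) K
      fun ρ => (d : ℝ) + (k + selectCost d (max ρ (k - 1 - ρ))), hk]
  simp only [add_assoc]

end Selection

/-! ### Halving the agents by a threshold cut -/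

section DivideAndConquer

variable {n m : ℕ} (Pl H : Finset (Fin m)) (slot : Fin m → ℕ)

/-- The plain items at positions in `[p, q)`, and the holes with slots in `[r, r + k)`. -/
def nodeItems (p q r k : ℕ) : Finset (Fin m) :=
  Finset.univ.filter fun e =>
    (e ∈ Pl ∧ p ≤ (e : ℕ) ∧ (e : ℕ) < q) ∨ (e ∈ H ∧ r ≤ slot e ∧ slot e < r + k)

variable {Pl H slot}

lemma mem_nodeItems {p q r k : ℕ} {e : Fin m} : e ∈ nodeItems Pl H slot p q r k ↔
    (e ∈ Pl ∧ p ≤ (e : ℕ) ∧ (e : ℕ) < q) ∨ (e ∈ H ∧ r ≤ slot e ∧ slot e < r + k) := by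
  simp [nodeItems]

lemma card_holes_le (hslot : Set.InjOn slot H) (r k : ℕ) :
    (H.filter fun e => r ≤ slot e ∧ slot e < r + k).card ≤ k := by
  classical
  have h := Finset.card_le_card_of_injOn (s := H.filter fun e => r ≤ slot e ∧ slot e < r + k)
    (t := Finset.Ico r (r + k)) slot (fun e he => ?_) fun e he e' he' h => ?_
  · simpa using h
  · have := (Finset.mem_filter.1 he).2
    simpa using this
  · exact hslot (Finset.mem_filter.1 he).1 (Finset.mem_filter.1 he').1 h

/-- A moving knife: `c` is the first position at which the left part is sufficient for `a` agents.
The knife stops just behind a plain item, which is not big, so the right part remains sufficient for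
`b`. -/
lemma exists_cut (hn : 1 ≤ n) (hPH : Disjoint Pl H) (hslot : Set.InjOn slot H) {v : Valuation m}
    (hv : ∀ e ∈ Pl, ¬ IsBig n v e) {a b p q r : ℕ} (hab : a ≤ b) (hpq : p ≤ q) (hqm : q ≤ m)
    (h : Suffices n v (nodeItems Pl H slot p q r (a + b)) (a + b)) :
    ∃ c, p ≤ c ∧ c ≤ q ∧ Suffices n v (nodeItems Pl H slot p c r a) a ∧
      Suffices n v (nodeItems Pl H slot c q (r + a) b) b := by
  classical
  -- At the right end the left part lacks only the at most `b` holes of the right slots.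
  have hq : Suffices n v (nodeItems Pl H slot p q r a) a := by
    rw [add_comm a b] at h
    refine h.of_card hn (card_holes_le hslot (r + a) b) (fun e he => ?_) (fun e he => ?_)
    · rw [mem_nodeItems] at he ⊢
      rcases he with he | he
      · exact .inl he
      · exact .inr ⟨he.1, he.2.1, by omega⟩
    · simp only [Finset.mem_union, Finset.mem_filter, mem_nodeItems] at he ⊢
      rcases he with he | ⟨h1, h2, h3⟩
      · exact .inr (.inl he)
      · rcases lt_or_ge (slot e) (r + a) with h4 | h4
        · exact .inr (.inr ⟨h1, h2, h4⟩)
        · exact .inl ⟨h1, h4, by omega⟩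
  have hex : ∃ c, p ≤ c ∧ Suffices n v (nodeItems Pl H slot p c r a) a := ⟨q, hpq, hq⟩
  set c := Nat.find hex with hc
  have hcq : c ≤ q := Nat.find_min' hex ⟨hpq, hq⟩
  obtain ⟨hpc, hcs⟩ := Nat.find_spec hex
  refine ⟨c, hpc, hcq, hcs, ?_⟩
  have hsub : nodeItems Pl H slot c q (r + a) b ⊆ nodeItems Pl H slot p q r (a + b) := by
    intro e he
    rw [mem_nodeItems] at he ⊢
    rcases he with he | he
    · exact .inl ⟨he.1, hpc.trans he.2.1, he.2.2⟩
    · exact .inr ⟨he.1, by omega, by omega⟩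
  -- If the knife does not move, the right part loses only the at most `a` holes of the left slots.
  rcases hpc.eq_or_lt with hpc' | hpc'
  · refine h.of_card hn (card_holes_le hslot r a) hsub (fun e he => ?_)
    simp only [Finset.mem_union, Finset.mem_filter, mem_nodeItems] at he ⊢
    rcases he with he | ⟨h1, h2, h3⟩
    · exact .inr (.inl ⟨he.1, hpc'.symm.trans_le he.2.1, he.2.2⟩)
    · rcases lt_or_ge (slot e) (r + a) with h4 | h4
      · exact .inl ⟨h1, h2, h4⟩
      · exact .inr (.inr ⟨h1, h4, by omega⟩)
  · have hnot : ¬ Suffices n v (nodeItems Pl H slot p (c - 1) r a) a := fun hcon =>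
      Nat.find_min hex (m := c - 1) (by omega) ⟨by omega, hcon⟩
    set e₀ : Fin m := ⟨c - 1, by omega⟩ with he₀
    have hval : (e₀ : ℕ) = c - 1 := rfl
    by_cases hmem : e₀ ∈ Pl
    · have hH : e₀ ∉ H := Finset.disjoint_left.1 hPH hmem
      refine h.of_not_suffices hn hab hnot (p := e₀) ?_ ?_ (hv _ hmem) ?_ hsub ?_
      · rw [mem_nodeItems, not_or]
        exact ⟨fun h => by omega, fun h => hH h.1⟩
      · rw [mem_nodeItems, not_or]
        exact ⟨fun h => by omega, fun h => hH h.1⟩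
      · refine Finset.disjoint_left.2 fun e h1 h2 => ?_
        rw [mem_nodeItems] at h1 h2
        rcases h1 with h1 | h1 <;> rcases h2 with h2 | h2
        · omega
        · exact Finset.disjoint_left.1 hPH h1.1 h2.1
        · exact Finset.disjoint_left.1 hPH h2.1 h1.1
        · omega
      · ext e
        simp only [Finset.mem_union, Finset.mem_insert, mem_nodeItems]
        have hee : e = e₀ ↔ (e : ℕ) = c - 1 := by rw [Fin.ext_iff]
        constructor
        · rintro (⟨h1, h2, h3⟩ | ⟨h1, h2, h3⟩)
          · rcases lt_trichotomy (e : ℕ) (c - 1) with h4 | h4 | h4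
            · exact .inl (.inr (.inl ⟨h1, h2, h4⟩))
            · exact .inl (.inl (hee.2 h4))
            · exact .inr (.inl ⟨h1, by omega, h3⟩)
          · rcases lt_or_ge (slot e) (r + a) with h4 | h4
            · exact .inl (.inr (.inr ⟨h1, h2, h4⟩))
            · exact .inr (.inr ⟨h1, h4, by omega⟩)
        · rintro ((h1 | h1 | h1) | h1 | h1)
          · exact .inl ⟨h1 ▸ hmem, by have := hee.1 h1; omega, by have := hee.1 h1; omega⟩
          · exact .inl ⟨h1.1, h1.2.1, by omega⟩
          · exact .inr ⟨h1.1, h1.2.1, by omega⟩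
          · exact .inl ⟨h1.1, by omega, h1.2.2⟩
          · exact .inr ⟨h1.1, by omega, by omega⟩
    -- If the item at position c - 1 is not plain, moving the knife past it changes nothing, against
    -- the minimality of `c`.
    · refine absurd (hcs.mono fun e he => ?_) hnot
      rw [mem_nodeItems] at he ⊢
      rcases he with ⟨h1, h2, h3⟩ | he
      · refine .inl ⟨h1, h2, lt_of_le_of_ne (by omega) fun h4 => hmem ?_⟩
        rwa [show e₀ = e from Fin.ext (hval.trans h4.symm)]
      · exact .inr he

variable (Pl H slot)

/-- The items of a node are divided among the agents of `G`: the agents occupy different slots of the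
node (`τ j` is the slot of agent `j`), each hole goes to the agent in its slot, the plain items are
cut into consecutive blocks in the order of the slots, and everybody gets a sufficient bundle. -/
def IsNodeSolution (x : Fin n → Valuation m) (G : Finset (Fin n)) (p q r : ℕ)
    (A : Allocation n m) : Prop :=
  ∃ τ : Fin n → ℕ, (∀ j ∈ G, r ≤ τ j ∧ τ j < r + G.card) ∧ Set.InjOn τ G ∧
    (∀ e ∈ nodeItems Pl H slot p q r G.card, A e ∈ G ∧ (e ∈ H → τ (A e) = slot e)) ∧
    (∀ e ∈ nodeItems Pl H slot p q r G.card, ∀ e' ∈ nodeItems Pl H slot p q r G.card,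
      e ∈ Pl → e' ∈ Pl → e ≤ e' → τ (A e) ≤ τ (A e')) ∧
    ∀ j ∈ G, Suffices n (x j) ((nodeItems Pl H slot p q r G.card).filter fun e => A e = j) 1

variable {Pl H slot}

lemma IsNodeSolution.combine (hPH : Disjoint Pl H) {x : Fin n → Valuation m}
    {L G : Finset (Fin n)} (hLG : L ⊆ G) {p c q r : ℕ} (hpc : p ≤ c) (hcq : c ≤ q)
    {A₁ A₂ : Allocation n m} (h₁ : IsNodeSolution Pl H slot x L p c r A₁)
    (h₂ : IsNodeSolution Pl H slot x (G \ L) c q (r + L.card) A₂) :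
    IsNodeSolution Pl H slot x G p q r
      fun e => if e ∈ nodeItems Pl H slot p c r L.card then A₁ e else A₂ e := by
  classical
  obtain ⟨τ₁, a1, a2, a3, a4, a5⟩ := h₁
  obtain ⟨τ₂, b1, b2, b3, b4, b5⟩ := h₂
  have hcard : L.card + (G \ L).card = G.card := by
    rw [add_comm]; exact Finset.card_sdiff_add_card_eq_card hLG
  set I₁ := nodeItems Pl H slot p c r L.card with hI₁
  set I₂ := nodeItems Pl H slot c q (r + L.card) (G \ L).card with hI₂
  have hI : ∀ e, e ∈ nodeItems Pl H slot p q r G.card ↔ e ∈ I₁ ∨ e ∈ I₂ := by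
    intro e
    simp only [hI₁, hI₂, mem_nodeItems]
    constructor
    · rintro (⟨h1, h2, h3⟩ | ⟨h1, h2, h3⟩)
      · rcases lt_or_ge (e : ℕ) c with h4 | h4
        · exact .inl (.inl ⟨h1, h2, h4⟩)
        · exact .inr (.inl ⟨h1, h4, h3⟩)
      · rcases lt_or_ge (slot e) (r + L.card) with h4 | h4
        · exact .inl (.inr ⟨h1, h2, h4⟩)
        · exact .inr (.inr ⟨h1, h4, by omega⟩)
    · rintro ((h | h) | (h | h))
      · exact .inl ⟨h.1, h.2.1, by omega⟩
      · exact .inr ⟨h.1, h.2.1, by omega⟩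
      · exact .inl ⟨h.1, by omega, h.2.2⟩
      · exact .inr ⟨h.1, by omega, by omega⟩
  have hdis : ∀ e ∈ I₂, e ∉ I₁ := by
    intro e h2 h1
    rw [hI₁, mem_nodeItems] at h1
    rw [hI₂, mem_nodeItems] at h2
    rcases h1 with h1 | h1 <;> rcases h2 with h2 | h2
    · omega
    · exact Finset.disjoint_left.1 hPH h1.1 h2.1
    · exact Finset.disjoint_left.1 hPH h2.1 h1.1
    · omega
  set A : Allocation n m := fun e => if e ∈ I₁ then A₁ e else A₂ e with hA
  set τ : Fin n → ℕ := fun j => if j ∈ L then τ₁ j else τ₂ j with hτ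
  have hτL : ∀ j ∈ L, τ j = τ₁ j := fun j hj => if_pos hj
  have hτR : ∀ j ∈ G \ L, τ j = τ₂ j := fun j hj => if_neg (Finset.mem_sdiff.1 hj).2
  have hA1 : ∀ e ∈ I₁, A e = A₁ e := fun e he => if_pos he
  have hA2 : ∀ e ∈ I₂, A e = A₂ e := fun e he => if_neg (hdis e he)
  have hsplit : ∀ j ∈ G, j ∈ L ∨ j ∈ G \ L := fun j hj => by
    by_cases h : j ∈ L
    · exact .inl h
    · exact .inr (Finset.mem_sdiff.2 ⟨hj, h⟩)
  have ht1 : ∀ e ∈ I₁, τ (A e) = τ₁ (A₁ e) := fun e he => by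
    rw [hA1 e he, hτL _ (a3 e he).1]
  have ht2 : ∀ e ∈ I₂, τ (A e) = τ₂ (A₂ e) := fun e he => by
    rw [hA2 e he, hτR _ (b3 e he).1]
  refine ⟨τ, fun j hj => ?_, fun i hi j hj hij => ?_, fun e he => ?_,
    fun e he e' he' heP heP' hle => ?_, fun j hj => ?_⟩
  · rcases hsplit j hj with h | h
    · rw [hτL j h]; have := a1 j h; omega
    · rw [hτR j h]; have := b1 j h; omega
  · rcases hsplit i hi with h | h <;> rcases hsplit j hj with h' | h'
    · rw [hτL i h, hτL j h'] at hij; exact a2 h h' hij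
    · rw [hτL i h, hτR j h'] at hij; have := a1 i h; have := b1 j h'; omega
    · rw [hτR i h, hτL j h'] at hij; have := b1 i h; have := a1 j h'; omega
    · rw [hτR i h, hτR j h'] at hij; exact b2 h h' hij
  · rcases (hI e).1 he with h | h
    · rw [ht1 e h, hA1 e h]
      exact ⟨hLG (a3 e h).1, (a3 e h).2⟩
    · rw [ht2 e h, hA2 e h]
      exact ⟨Finset.sdiff_subset (b3 e h).1, (b3 e h).2⟩
  · rcases (hI e).1 he with h | h <;> rcases (hI e').1 he' with h' | h'
    · rw [ht1 e h, ht1 e' h']; exact a4 e h e' h' heP heP' hle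
    · rw [ht1 e h, ht2 e' h']
      have := a1 _ (a3 e h).1; have := b1 _ (b3 e' h').1; omega
    · exfalso
      have hH := Finset.disjoint_left.1 hPH heP
      have hH' := Finset.disjoint_left.1 hPH heP'
      rw [hI₂, mem_nodeItems] at h
      rw [hI₁, mem_nodeItems] at h'
      have : (e : ℕ) ≤ e' := hle
      rcases h with h | h
      · rcases h' with h' | h'
        · omega
        · exact hH' h'.1
      · exact hH h.1
    · rw [ht2 e h, ht2 e' h']; exact b4 e h e' h' heP heP' hle
  · rcases hsplit j hj with h | h
    · refine (a5 j h).mono fun e he => ?_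
      obtain ⟨h1, h2⟩ := Finset.mem_filter.1 he
      exact Finset.mem_filter.2 ⟨(hI e).2 (.inl h1), (hA1 e h1).trans h2⟩
    · refine (b5 j h).mono fun e he => ?_
      obtain ⟨h1, h2⟩ := Finset.mem_filter.1 he
      exact Finset.mem_filter.2 ⟨(hI e).2 (.inr h1), (hA2 e h1).trans h2⟩

/-- `σ k` bounds the cost of selecting some of `k` agents by means of keys in `{0, …, m}`. -/
def SelectCost (rand : Prop) (n m : ℕ) (σ : ℕ → ℝ) : Prop :=
  ∀ (key : Fin n → Valuation m → Fin (m + 1)) (G : Finset (Fin n)) (a : ℕ), 1 ≤ a → a < G.card →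
    Solvable rand (Set.univ : Set (Fin n → Valuation m))
      (fun x => IsSplit (fun j => key j (x j)) G a) (fun _ => σ G.card)

lemma Solvable.divideAndConquer {rand : Prop} (hn : 1 ≤ n) (hPH : Disjoint Pl H)
    (hslot : Set.InjOn slot H) {σ T : ℕ → ℝ} (hσ : SelectCost rand n m σ) (hT1 : 0 ≤ T 1)
    (hT : ∀ k, 2 ≤ k → σ k + (T (k / 2) + T (k - k / 2)) ≤ T k) (G : Finset (Fin n))
    (hG : 1 ≤ G.card) {p q r : ℕ} (hpq : p ≤ q) (hqm : q ≤ m) :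
    Solvable rand {x : Fin n → Valuation m | ∀ j ∈ G,
        Suffices n (x j) (nodeItems Pl H slot p q r G.card) G.card ∧ ∀ e ∈ Pl, ¬ IsBig n (x j) e}
      (fun x A => IsNodeSolution Pl H slot x G p q r A) (fun _ => T G.card) := by
  classical
  have hn0 : Nonempty (Fin n) := ⟨⟨0, by omega⟩⟩
  induction hk : G.card using Nat.strong_induction_on generalizing G p q r with
  | _ k ih =>
  subst hk
  rcases hG.eq_or_lt with h1 | h2
  · obtain ⟨i, rfl⟩ := Finset.card_eq_one.1 h1.symm
    refine Solvable.pure (fun _ => i) (fun x hx => ?_) (fun _ _ => by rw [← h1]; exact hT1)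
    refine ⟨fun _ => r, by simp, by simp, fun e he => ⟨by simp, fun heH => ?_⟩,
      fun _ _ _ _ _ _ _ => le_rfl, fun j hj => ?_⟩
    · rw [mem_nodeItems] at he
      rcases he with he | he
      · exact absurd heH (Finset.disjoint_left.1 hPH he.1)
      · simp only [Finset.card_singleton] at he; change r = slot e; omega
    · rw [Finset.mem_singleton] at hj
      subst hj
      have := (hx j (by simp)).1
      simpa using this
  · set k := G.card with hk
    set a := k / 2 with ha
    set b := k - k / 2 with hb
    have hab : a + b = k := by omega
    have hle : a ≤ b := by omega
    let P : Valuation m → ℕ → Prop := fun y c => p ≤ c ∧ c ≤ q ∧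
      Suffices n y (nodeItems Pl H slot p c r a) a ∧
      Suffices n y (nodeItems Pl H slot c q (r + a) b) b
    -- The key is a cut acceptable on both sides; the default 0 never occurs among agents of the
    -- node on the promised inputs.
    let key : Fin n → Valuation m → Fin (m + 1) := fun _ y =>
      if h : ∃ c, P y c then ⟨h.choose, by have := h.choose_spec.2.1; omega⟩ else 0
    have hkey : ∀ x ∈ {x : Fin n → Valuation m | ∀ j ∈ G,
        Suffices n (x j) (nodeItems Pl H slot p q r k) k ∧ ∀ e ∈ Pl, ¬ IsBig n (x j) e},
        ∀ j ∈ G, P (x j) (key j (x j)) := by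
      intro x hx j hj
      have h : ∃ c, P (x j) c :=
        exists_cut hn hPH hslot (hx j hj).2 hle hpq hqm (hab ▸ (hx j hj).1)
      have : (key j (x j) : ℕ) = h.choose := by simp only [key, dif_pos h]
      rw [this]
      exact h.choose_spec
    refine (((hσ key G a (by omega) (by omega)).mono (Set.subset_univ _) (fun _ _ _ h => h)
      (fun _ _ => le_rfl)).bind (β₂ := fun _ => T a + T b) ?_).mono subset_rfl
      (fun _ _ _ h => h) (fun _ _ => hT k h2)
    rintro ⟨c, L⟩
    -- Composition quantifies over all conceivable outcomes. Those that no promised input produces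
    -- are discharged vacuously.
    by_cases hLG : L ⊆ G ∧ L.card = a ∧ p ≤ (c : ℕ) ∧ (c : ℕ) ≤ q
    swap
    · have hcon : ∀ x : Fin n → Valuation m, ((∀ j ∈ G, Suffices n (x j) (nodeItems Pl H slot p q r k) k ∧
          ∀ e ∈ Pl, ¬ IsBig n (x j) e) ∧ IsSplit (fun j => key j (x j)) G a (c, L)) → False := by
        rintro x ⟨hx, h1, h2, h3, h4⟩
        replace h1 : L ⊆ G := h1
        replace h2 : L.card = a := h2
        refine hLG ⟨h1, h2, ?_, ?_⟩
        · obtain ⟨j, hj⟩ : L.Nonempty := Finset.card_pos.1 (by omega)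
          exact (hkey x hx j (h1 hj)).1.trans (h3 j hj)
        · obtain ⟨j, hj⟩ : (G \ L).Nonempty := Finset.card_pos.1 (by
            rw [Finset.card_sdiff_of_subset h1]; omega)
          obtain ⟨hj1, hj2⟩ := Finset.mem_sdiff.1 hj
          have : (c : ℕ) ≤ key j (x j) := h4 j hj1 hj2
          exact this.trans (hkey x hx j hj1).2.1
      exact Solvable.pure (fun _ => Classical.arbitrary _) (fun x hx => (hcon x hx).elim)
        (fun x hx => (hcon x hx).elim)
    obtain ⟨hL, hLa, hpc, hcq⟩ := hLG
    have hRb : (G \ L).card = b := by rw [Finset.card_sdiff_of_subset hL]; omega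
    have hleft := ih a (by omega) L (p := p) (q := c) (r := r) (by omega) hpc (hcq.trans hqm) hLa
    have hright := ih b (by omega) (G \ L) (p := c) (q := q) (r := r + a) (by omega) hcq hqm hRb
    refine (hleft.mono ?_ (fun _ _ _ h => h) (fun _ _ => le_rfl)).bind (β₂ := fun _ => T b)
      fun A₁ => ?_
    · rintro x ⟨hx, h1, h2, h3, h4⟩ j hj
      refine ⟨?_, (hx j (hL hj)).2⟩
      -- The common cut lies at or beyond the cut this agent named, so the left part contains the
      -- one she accepted. The right side is symmetric.
      refine (hkey x hx j (hL hj)).2.2.1.mono fun e he => ?_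
      have : (key j (x j) : ℕ) ≤ c := h3 j hj
      rw [mem_nodeItems] at he ⊢
      rcases he with he | he
      · exact .inl ⟨he.1, he.2.1, by omega⟩
      · exact .inr he
    · refine (hright.mono ?_ (fun _ _ _ h => h) (fun _ _ => le_rfl)).map
        (fun A₂ e => if e ∈ nodeItems Pl H slot p c r L.card then A₁ e else A₂ e) ?_
      · rintro x ⟨⟨hx, h1, h2, h3, h4⟩, -⟩ j hj
        obtain ⟨hj1, hj2⟩ := Finset.mem_sdiff.1 hj
        refine ⟨?_, (hx j hj1).2⟩
        refine (hkey x hx j hj1).2.2.2.mono fun e he => ?_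
        have : (c : ℕ) ≤ key j (x j) := h4 j hj1 hj2
        rw [mem_nodeItems] at he ⊢
        rcases he with he | he
        · exact .inl ⟨he.1, by omega, he.2.2⟩
        · exact .inr he
      · rintro x ⟨-, hA₁⟩ A₂ hA₂
        rw [← hLa] at hA₂
        exact hA₁.combine hPH hL hpc hcq hA₂

end DivideAndConquer

/-! ### Taken items, holes and structured allocations -/

section Structure

variable {n m : ℕ}

/-- The number of elements of `S` below `e`. -/
def rankIn (S : Finset (Fin m)) (e : Fin m) : ℕ := (S.filter fun e' => e' < e).card

lemma rankIn_lt_rankIn {S : Finset (Fin m)} {e e' : Fin m} (he : e ∈ S) (h : e < e') :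
    rankIn S e < rankIn S e' := by
  refine Finset.card_lt_card (Finset.ssubset_iff_of_subset (fun x hx => ?_) |>.2 ⟨e, ?_, ?_⟩)
  · obtain ⟨h1, h2⟩ := Finset.mem_filter.1 hx
    exact Finset.mem_filter.2 ⟨h1, h2.trans h⟩
  · exact Finset.mem_filter.2 ⟨he, h⟩
  · simp

lemma rankIn_injOn (S : Finset (Fin m)) : Set.InjOn (rankIn S) S := by
  intro e he e' he' h
  rcases lt_trichotomy e e' with h1 | h1 | h1
  · exact absurd h (rankIn_lt_rankIn he h1).ne
  · exact h1
  · exact absurd h (rankIn_lt_rankIn he' h1).ne'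

lemma rankIn_lt_card {S : Finset (Fin m)} {e : Fin m} (he : e ∈ S) : rankIn S e < S.card :=
  Finset.card_lt_card (Finset.ssubset_iff_of_subset (Finset.filter_subset _ _) |>.2
    ⟨e, he, by simp⟩)

/-- The items that are taken when agent `j` takes the item `s j`. -/
def takenItems (s : Fin n → Option (Fin m)) : Finset (Fin m) :=
  Finset.univ.filter fun e => ∃ j, s j = some e

lemma mem_takenItems {s : Fin n → Option (Fin m)} {e : Fin m} :
    e ∈ takenItems s ↔ ∃ j, s j = some e := by simp [takenItems]

/-- The agents who have not taken an item. -/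
def waiting (s : Fin n → Option (Fin m)) : Finset (Fin n) :=
  Finset.univ.filter fun j => s j = none

lemma card_takenItems_add {s : Fin n → Option (Fin m)}
    (hs : ∀ j j' e, s j = some e → s j' = some e → j = j') :
    (takenItems s).card + (waiting s).card = n := by
  classical
  have h1 : (takenItems s).image some = (Finset.univ.filter fun j => ¬ s j = none).image s := by
    ext o
    simp only [Finset.mem_image, mem_takenItems, Finset.mem_filter, Finset.mem_univ, true_and]
    constructor
    · rintro ⟨e, ⟨j, hj⟩, rfl⟩
      exact ⟨j, by simp [hj], hj⟩
    · rintro ⟨j, hj, rfl⟩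
      obtain ⟨e, he⟩ := Option.ne_none_iff_exists'.1 hj
      exact ⟨e, ⟨j, he⟩, he.symm⟩
  have h2 := congrArg Finset.card h1
  rw [Finset.card_image_of_injective _ (Option.some_injective _), Finset.card_image_of_injOn] at h2
  · rw [h2, waiting, add_comm, Finset.card_filter_add_card_filter_not]
    simp
  · intro j hj j' _ h
    obtain ⟨e, he⟩ := Option.ne_none_iff_exists'.1 (Finset.mem_filter.1 hj).2
    exact hs j j' e he (h ▸ he)

/-- Waiting agents keep their slots in front, and agents who have taken an item come behind, in the
order of their items. The owner of a taken item can thus be read off from its rank, up to the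
relabelling. -/
lemma exists_perm_slots {s : Fin n → Option (Fin m)}
    (hs : ∀ j j' e, s j = some e → s j' = some e → j = j') {τ : Fin n → ℕ}
    (hτ : ∀ j ∈ waiting s, τ j < (waiting s).card) (hinj : Set.InjOn τ (waiting s)) :
    ∃ σ : Equiv.Perm (Fin n), (∀ j ∈ waiting s, (σ j : ℕ) = τ j) ∧
      ∀ j e, s j = some e → (σ j : ℕ) = n - (takenItems s).card + rankIn (takenItems s) e := by
  have hcard := card_takenItems_add hs
  have hf : ∀ j, ∃ i : Fin n, (j ∈ waiting s → (i : ℕ) = τ j) ∧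
      ∀ e, s j = some e → (i : ℕ) = n - (takenItems s).card + rankIn (takenItems s) e := by
    intro j
    rcases h : s j with _ | e
    · have hj : j ∈ waiting s := by simp [waiting, h]
      exact ⟨⟨τ j, by have := hτ j hj; omega⟩, fun _ => rfl, by simp⟩
    · have := rankIn_lt_card (mem_takenItems.2 ⟨j, h⟩)
      refine ⟨⟨n - (takenItems s).card + rankIn (takenItems s) e, by omega⟩, fun hj => ?_, ?_⟩
      · simp [waiting, h] at hj
      · rintro e' he'
        obtain rfl := Option.some_inj.1 he'
        rfl
  choose f hf1 hf2 using hf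
  have hfinj : Function.Injective f := by
    intro i j hij
    have hij' : (f i : ℕ) = f j := congrArg _ hij
    rcases hi : s i with _ | e <;> rcases hj : s j with _ | e'
    · have hi' : i ∈ waiting s := by simp [waiting, hi]
      have hj' : j ∈ waiting s := by simp [waiting, hj]
      rw [hf1 i hi', hf1 j hj'] at hij'
      exact hinj hi' hj' hij'
    · have hi' : i ∈ waiting s := by simp [waiting, hi]
      rw [hf1 i hi', hf2 j e' hj] at hij'
      have := hτ i hi'
      omega
    · have hj' : j ∈ waiting s := by simp [waiting, hj]
      rw [hf2 i e hi, hf1 j hj'] at hij'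
      have := hτ j hj'
      omega
    · rw [hf2 i e hi, hf2 j e' hj] at hij'
      have := rankIn_injOn _ (mem_takenItems.2 ⟨i, hi⟩) (mem_takenItems.2 ⟨j, hj⟩)
        (Nat.add_left_cancel hij')
      exact hs i j e hi (this ▸ hj)
  exact ⟨Equiv.ofBijective f (Finite.injective_iff_bijective.1 hfinj), hf1, hf2⟩

/-- The running maximum over the elements of `Pl` seen so far, with value 0 before the first one. -/
lemma exists_monotone_eqOn (hn : 1 ≤ n) (f : Fin m → Fin n) (Pl : Finset (Fin m))
    (hf : ∀ e ∈ Pl, ∀ e' ∈ Pl, e ≤ e' → f e ≤ f e') :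
    ∃ g : Fin m → Fin n, Monotone g ∧ ∀ e ∈ Pl, g e = f e := by
  refine ⟨fun e => ⟨(Pl.filter (· ≤ e)).sup fun e' => (f e' : ℕ), ?_⟩, fun e e' h => ?_,
    fun e he => ?_⟩
  · rw [Finset.sup_lt_iff (by simpa using Nat.pos_of_ne_zero (by omega))]
    exact fun e' _ => (f e').2
  · change (Pl.filter (· ≤ e)).sup (fun e' => (f e' : ℕ)) ≤ _
    exact Finset.sup_mono (Finset.monotone_filter_right _ fun _ _ h' => le_trans h' h)
  · refine Fin.ext (le_antisymm (Finset.sup_le fun e' he' => ?_) ?_)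
    · exact hf e' (Finset.mem_filter.1 he').1 e he (Finset.mem_filter.1 he').2
    · exact Finset.le_sup (f := fun e' => (f e' : ℕ)) (Finset.mem_filter.2 ⟨he, le_rfl⟩)

/-- `Aprop` allocations with a short description: `S` is a set of items that make up the whole
bundle of an agent, `H` is a set of further holes, and the other items form consecutive blocks. If
all agents have the same valuation, then there is at most one further hole. -/
def IsStructured (x : Fin n → Valuation m) (A : Allocation n m) : Prop :=
  Aprop x A ∧ ∃ (blk : Fin m → Fin n) (σ : Equiv.Perm (Fin n)) (S H : Finset (Fin m)),
    Monotone blk ∧ S.card + H.card ≤ n ∧ (∀ e, e ∉ S → e ∉ H → blk e = σ (A e)) ∧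
    (∀ e ∈ S, (σ (A e) : ℕ) = n - S.card + rankIn S e) ∧
    (∀ e e', e ∈ S ∨ e ∈ H → e' ∈ S ∨ e' ∈ H → A e = A e' → e = e') ∧
    (x ∈ identical n m → H.card ≤ 1)

lemma IsStructured.semiContiguous {x : Fin n → Valuation m} {A : Allocation n m}
    (h : IsStructured x A) : SemiContiguous A := by
  classical
  obtain ⟨-, blk, σ, S, H, h1, h2, h3, -, h5, -⟩ := h
  refine ⟨blk, S ∪ H, σ, h1, (Finset.card_union_le _ _).trans h2, fun e he => ?_, ?_⟩
  · rw [Finset.mem_union, not_or] at he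
    exact h3 e he.1 he.2
  · intro e he e' he' hee
    exact h5 e e' (by simpa using he) (by simpa using he') hee

/-- Outcome of the first stage, after the agents in `D` have been asked in turn: whoever sees a free
item that is sufficient for her takes such an item. -/
def IsTaking (x : Fin n → Valuation m) (D : Finset (Fin n)) (s : Fin n → Option (Fin m)) : Prop :=
  (∀ j, j ∉ D → s j = none) ∧ (∀ j j' e, s j = some e → s j' = some e → j = j') ∧
    (∀ j e, s j = some e → Suffices n (x j) {e} 1) ∧
    ∀ j ∈ D, s j = none → ∀ e, e ∉ takenItems s → ¬ Suffices n (x j) {e} 1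

lemma Solvable.taking {rand : Prop} {d : ℕ} (hd : m + 1 ≤ 2 ^ d) (D : Finset (Fin n)) :
    Solvable rand (Set.univ : Set (Fin n → Valuation m)) (fun x s => IsTaking x D s)
      (fun _ => D.card * d) := by
  classical
  induction D using Finset.induction_on with
  | empty =>
    exact Solvable.pure (fun _ => none)
      (fun x _ => ⟨fun _ _ => rfl, by simp, by simp, by simp⟩) (by simp)
  | insert i D hi ih =>
    refine (ih.bind (β₂ := fun _ => d) (F := fun x s => IsTaking x (insert i D) s)
      fun s => ?_).mono subset_rfl (fun _ _ _ h => h) (fun x _ => ?_)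
    swap
    · rw [Finset.card_insert_of_notMem hi]
      push_cast
      linarith
    let f : Valuation m → Option (Fin m) := fun y =>
      if h : ∃ e, e ∉ takenItems s ∧ Suffices n y {e} 1 then some h.choose else none
    have hf1 : ∀ y e, f y = some e → e ∉ takenItems s ∧ Suffices n y {e} 1 := by
      intro y e h
      simp only [f] at h
      split_ifs at h with h'
      rw [← Option.some_inj.1 h]
      exact h'.choose_spec
    have hf2 : ∀ y, f y = none → ∀ e, e ∉ takenItems s → ¬ Suffices n y {e} 1 := by
      intro y h e he hs
      simp only [f] at h
      rw [dif_pos ⟨e, he, hs⟩] at h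
      simp at h
    refine ((Solvable.ask i f (d := d) (by simpa using hd)).mono (Set.subset_univ _)
      (fun _ _ _ h => h) (fun _ _ => le_rfl)).map (fun o => Function.update s i o) ?_
    rintro x ⟨-, h1, h2, h3, h4⟩ o rfl
    have hsi : s i = none := h1 i hi
    set s' := Function.update s i (f (x i)) with hs'
    have hi' : s' i = f (x i) := by simp [hs']
    have hne : ∀ j, j ≠ i → s' j = s j := fun j hj => by simp [hs', hj]
    have htaken : ∀ e, e ∈ takenItems s → e ∈ takenItems s' := by
      intro e he
      obtain ⟨j, hj⟩ := mem_takenItems.1 he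
      refine mem_takenItems.2 ⟨j, ?_⟩
      rw [hne j (by rintro rfl; rw [hsi] at hj; simp at hj), hj]
    refine ⟨fun j hj => ?_, fun j j' e hj hj' => ?_, fun j e hj => ?_, fun j hj hjn e he => ?_⟩
    · rw [Finset.mem_insert, not_or] at hj
      rw [hne j hj.1, h1 j hj.2]
    · by_cases hji : j = i <;> by_cases hji' : j' = i
      · rw [hji, hji']
      · rw [hji, hi'] at hj
        rw [hne j' hji'] at hj'
        exact absurd (mem_takenItems.2 ⟨j', hj'⟩) (hf1 _ _ hj).1
      · rw [hji', hi'] at hj'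
        rw [hne j hji] at hj
        exact absurd (mem_takenItems.2 ⟨j, hj⟩) (hf1 _ _ hj').1
      · rw [hne j hji] at hj
        rw [hne j' hji'] at hj'
        exact h2 j j' e hj hj'
    · by_cases hji : j = i
      · rw [hji, hi'] at hj
        rw [hji]
        exact (hf1 _ _ hj).2
      · rw [hne j hji] at hj
        exact h3 j e hj
    · have he' : e ∉ takenItems s := fun h => he (htaken e h)
      by_cases hji : j = i
      · rw [hji, hi'] at hjn
        rw [hji]
        exact hf2 _ hjn e he'
      · rw [hne j hji] at hjn
        exact h4 j (Finset.mem_of_mem_insert_of_ne hj hji) hjn e he'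

lemma isStructured_of_taking_all (hn : 1 ≤ n) {x : Fin n → Valuation m}
    {s : Fin n → Option (Fin m)} (hs : IsTaking x Finset.univ s) (hG : waiting s = ∅)
    {A : Allocation n m} (hA : ∀ j e, s j = some e → A e = j) {j₀ : Fin n}
    (hA₀ : ∀ e, e ∉ takenItems s → A e = j₀) : IsStructured x A := by
  obtain ⟨-, h2, h3, h4⟩ := hs
  have hcard := card_takenItems_add h2
  have hsome : ∀ j, ∃ e, s j = some e := fun j => Option.ne_none_iff_exists'.1 fun h => by
    have : j ∈ waiting s := by simp [waiting, h]
    simp [hG] at this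
  obtain ⟨σ, -, hσ⟩ := exists_perm_slots h2 (τ := fun _ => 0) (by simp [hG]) (by simp [hG])
  refine ⟨aprop_of_suffices hn fun j => ?_, fun _ => σ j₀, σ, takenItems s, ∅, monotone_const,
    by simp only [Finset.card_empty]; omega, fun e he _ => by rw [hA₀ e he], fun e he => ?_,
    fun e e' he he' h => ?_, by simp⟩
  · obtain ⟨e, he⟩ := hsome j
    refine (h3 j e he).mono ?_
    simp [Allocation.bundle, hA j e he]
  · obtain ⟨j, hj⟩ := mem_takenItems.1 he
    rw [hA j e hj]
    exact hσ j e hj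
  · simp only [Finset.notMem_empty, or_false] at he he'
    obtain ⟨j, hj⟩ := mem_takenItems.1 he
    obtain ⟨j', hj'⟩ := mem_takenItems.1 he'
    rw [hA j e hj, hA j' e' hj'] at h
    rw [h, hj'] at hj
    exact (Option.some_inj.1 hj).symm

lemma isStructured_of_isNodeSolution (hn : 1 ≤ n) {x : Fin n → Valuation m}
    {s : Fin n → Option (Fin m)} (hs : IsTaking x Finset.univ s)
    {H : Finset (Fin m)} (hHs : ∀ e ∈ H, e ∉ takenItems s) (hHG : H.card ≤ (waiting s).card)
    (hid : x ∈ identical n m → H.card ≤ 1) {A' A : Allocation n m}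
    (hsol : IsNodeSolution (Finset.univ \ (takenItems s ∪ H)) H (rankIn H) x (waiting s) 0 m 0 A')
    (hA : ∀ j e, s j = some e → A e = j)
    (hA' : ∀ e, e ∉ takenItems s → A e = A' e) : IsStructured x A := by
  classical
  obtain ⟨-, h2, h3, h4⟩ := hs
  have hcard := card_takenItems_add h2
  have hI : ∀ e, e ∈ nodeItems (Finset.univ \ (takenItems s ∪ H)) H (rankIn H) 0 m 0
      (waiting s).card ↔ e ∉ takenItems s := by
    intro e
    simp only [mem_nodeItems, Finset.mem_sdiff, Finset.mem_univ, true_and, Finset.mem_union,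
      not_or]
    constructor
    · rintro (h | h)
      · exact h.1.1
      · exact hHs e h.1
    · intro h
      by_cases heH : e ∈ H
      · exact .inr ⟨heH, by omega, by have := rankIn_lt_card heH; omega⟩
      · exact .inl ⟨⟨h, heH⟩, by omega, e.2⟩
  obtain ⟨τ, t1, t2, t3, t4, t5⟩ := hsol
  obtain ⟨σ, hσ1, hσ2⟩ := exists_perm_slots h2 (τ := τ)
    (fun j hj => by have := t1 j hj; omega) t2
  have hG : ∀ e, e ∉ takenItems s → A e ∈ waiting s ∧ (e ∈ H → (σ (A e) : ℕ) = rankIn H e) := by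
    intro e he
    obtain ⟨g1, g2⟩ := t3 e ((hI e).2 he)
    rw [hA' e he]
    exact ⟨g1, fun h => (hσ1 _ g1).trans (g2 h)⟩
  obtain ⟨blk, hb1, hb2⟩ := exists_monotone_eqOn hn (fun e => σ (A e))
    (Finset.univ \ (takenItems s ∪ H)) (by
      intro e he e' he' hle
      have g : e ∉ takenItems s := by
        simp only [Finset.mem_sdiff, Finset.mem_union, not_or] at he; exact he.2.1
      have g' : e' ∉ takenItems s := by
        simp only [Finset.mem_sdiff, Finset.mem_union, not_or] at he'; exact he'.2.1
      have := t4 e ((hI e).2 g) e' ((hI e').2 g') he he' hle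
      rw [← hA' e g, ← hA' e' g', ← hσ1 _ (hG e g).1, ← hσ1 _ (hG e' g').1] at this
      exact this)
  have hS : ∀ e ∈ takenItems s, A e ∉ waiting s ∧ s (A e) = some e := by
    intro e he
    obtain ⟨j, hj⟩ := mem_takenItems.1 he
    rw [hA j e hj]
    exact ⟨by simp [waiting, hj], hj⟩
  refine ⟨aprop_of_suffices hn fun j => ?_, blk, σ, takenItems s, H, hb1, by omega,
    fun e heS heH => hb2 e (by simp [heS, heH]), fun e he => hσ2 _ e (hS e he).2,
    fun e e' he he' h => ?_, hid⟩
  · rcases h : s j with _ | e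
    · refine (t5 j (by simp [waiting, h])).mono fun e he => ?_
      obtain ⟨g1, g2⟩ := Finset.mem_filter.1 he
      simp only [Allocation.bundle, Finset.mem_filter, Finset.mem_univ, true_and]
      rw [hA' e ((hI e).1 g1), g2]
    · refine (h3 j e h).mono ?_
      simp [Allocation.bundle, hA j e h]
  · by_cases g : e ∈ takenItems s <;> by_cases g' : e' ∈ takenItems s
    · have g1 := (hS e g).2
      rw [h, (hS e' g').2] at g1
      exact (Option.some_inj.1 g1).symm
    · exact absurd (h ▸ (hG e' g').1) (hS e g).1
    · exact absurd (h ▸ (hG e g).1) (hS e' g').1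
    · have heH := he.resolve_left g
      have heH' := he'.resolve_left g'
      refine rankIn_injOn H heH heH' ?_
      rw [← (hG e g).2 heH, ← (hG e' g').2 heH', h]

/-- Taking items and announcing big items cost `n * d` bits each; what is left is the halving of the
waiting agents, whose cost obeys the recursion for `T`. -/
theorem Solvable.structured {rand : Prop} (hn : 1 ≤ n) {d : ℕ} (hd : m + 1 ≤ 2 ^ d)
    {σ T : ℕ → ℝ} (hσ : SelectCost rand n m σ) (hT1 : 0 ≤ T 1)
    (hT : ∀ k, 2 ≤ k → σ k + (T (k / 2) + T (k - k / 2)) ≤ T k) {B : ℝ} (hB : 0 ≤ B)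
    (hTB : ∀ k, 1 ≤ k → k ≤ n → T k ≤ B) :
    Solvable rand (Set.univ : Set (Fin n → Valuation m)) IsStructured
      (fun _ => 2 * (n * d) + B) := by
  classical
  have hn0 : Nonempty (Fin n) := ⟨⟨0, by omega⟩⟩
  refine ((Solvable.taking hd Finset.univ).bind (β₂ := fun _ => n * d + B) fun s => ?_).mono
    subset_rfl (fun _ _ _ h => h) (fun _ _ => by rw [Finset.card_univ, Fintype.card_fin]; linarith)
  let f : Valuation m → Option (Fin m) := fun y =>
    if h : ∃ e, e ∉ takenItems s ∧ IsBig n y e then some h.choose else none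
  have hf : ∀ y e, e ∉ takenItems s → IsBig n y e → ∃ e', f y = some e' ∧ IsBig n y e' := by
    intro y e he hy
    have h : ∃ e, e ∉ takenItems s ∧ IsBig n y e := ⟨e, he, hy⟩
    exact ⟨h.choose, dif_pos h, h.choose_spec.2⟩
  refine (((Solvable.askAll (fun _ => f) (d := d) (by simpa using hd) Finset.univ).mono
    (Set.subset_univ _) (fun _ _ _ h => h) (fun _ _ => le_rfl)).bind (β₂ := fun _ => B)
    fun g => ?_).mono subset_rfl (fun _ _ _ h => h)
    (fun _ _ => by rw [Finset.card_univ, Fintype.card_fin])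
  let owner : Allocation n m → Allocation n m := fun A' e =>
    if h : ∃ j, s j = some e then h.choose else A' e
  by_cases hs : ∀ j j' e, s j = some e → s j' = some e → j = j'
  swap
  · exact Solvable.pure (fun _ => Classical.arbitrary _) (fun x hx => absurd hx.1.2.2.1 hs)
      (fun x hx => absurd hx.1.2.2.1 hs)
  have howner1 : ∀ A' j e, s j = some e → owner A' e = j := by
    intro A' j e h
    have hex : ∃ j, s j = some e := ⟨j, h⟩
    exact (dif_pos hex).trans (hs _ _ e hex.choose_spec h)
  have howner2 : ∀ A' e, e ∉ takenItems s → owner A' e = A' e := fun A' e he =>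
    dif_neg fun h => he (mem_takenItems.2 h)
  rcases (waiting s).eq_empty_or_nonempty with hG | hG
  · exact Solvable.pure (owner fun _ => Classical.arbitrary _)
      (fun x hx => isStructured_of_taking_all hn hx.1.2 hG (howner1 _) (howner2 _))
      (fun _ _ => hB)
  have hG1 : 1 ≤ (waiting s).card := Finset.card_pos.2 hG
  have hGn : (waiting s).card ≤ n := by simpa using Finset.card_le_univ (waiting s)
  set H : Finset (Fin m) :=
    Finset.univ.filter fun e => e ∉ takenItems s ∧ ∃ j ∈ waiting s, g j = some e with hH
  have hHG : H.card ≤ (waiting s).card := by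
    have h1 : H.image some ⊆ (waiting s).image g := by
      intro o ho
      obtain ⟨e, he, rfl⟩ := Finset.mem_image.1 ho
      obtain ⟨-, -, j, hj, hgj⟩ := Finset.mem_filter.1 he
      exact Finset.mem_image.2 ⟨j, hj, hgj⟩
    have h2 := (Finset.card_le_card h1).trans Finset.card_image_le
    rwa [Finset.card_image_of_injective _ (Option.some_injective _)] at h2
  have hPH : Disjoint (Finset.univ \ (takenItems s ∪ H)) H :=
    Finset.disjoint_left.2 fun e he heH =>
    (Finset.mem_sdiff.1 he).2 (Finset.mem_union_right _ heH)
  refine ((Solvable.divideAndConquer hn hPH (rankIn_injOn H) hσ hT1 hT (waiting s) hG1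
    (Nat.zero_le m) le_rfl (r := 0)).mono ?_ (fun _ _ _ h => h) (fun _ _ => hTB _ hG1 hGn)).map
    owner ?_
  · rintro x ⟨⟨-, hx⟩, hg⟩ j hj
    obtain ⟨h1, h2, h3, h4⟩ := hx
    have hjn : s j = none := (Finset.mem_filter.1 hj).2
    refine ⟨?_, fun e he hbig => ?_⟩
    · have hcard := card_takenItems_add h2
      have key : Suffices n (x j) Finset.univ ((takenItems s).card + (waiting s).card) := by
        rw [hcard]; exact suffices_univ hn (x j)
      refine key.of_card hn le_rfl (Finset.subset_univ _) fun e _ => ?_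
      rw [Finset.mem_union, mem_nodeItems]
      by_cases he : e ∈ takenItems s
      · exact .inl he
      · by_cases heH : e ∈ H
        · have := rankIn_lt_card heH
          exact .inr (.inr ⟨heH, by omega, by omega⟩)
        · exact .inr (.inl ⟨by simp [he, heH], by omega, e.2⟩)
    · simp only [Finset.mem_sdiff, Finset.mem_univ, true_and, Finset.mem_union, not_or] at he
      obtain ⟨e', he', hbig'⟩ := hf (x j) e he.1 hbig
      -- A waiting agent has no second big item, so a free item that is big for her is the one she
      -- announced and belongs to `H`.
      have := eq_of_isBig hn hbig hbig' (h4 j (Finset.mem_univ _) hjn e he.1)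
      refine he.2 (Finset.mem_filter.2 ⟨Finset.mem_univ _, he.1, j, hj, ?_⟩)
      rw [hg j (Finset.mem_univ _), he', this]
  · rintro x ⟨⟨-, hx⟩, hg⟩ A' hA'
    refine isStructured_of_isNodeSolution hn hx (fun e he => (Finset.mem_filter.1 he).2.1) hHG ?_
      hA' (howner1 A') (howner2 A')
    -- With a common valuation everybody announces the same item, because the announcement depends
    -- on the valuation alone.
    rintro ⟨u, hu⟩
    refine Finset.card_le_one.2 fun e he e' he' => ?_
    obtain ⟨-, -, j, hj, h1⟩ := Finset.mem_filter.1 he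
    obtain ⟨-, -, j', hj', h2⟩ := Finset.mem_filter.1 he'
    rw [hg _ (Finset.mem_univ _), hu] at h1 h2
    rw [h1] at h2
    exact Option.some_inj.1 h2

end Structure

/-! ### Logarithms and the halving recursions -/

section Logarithms

lemma le_logb_add_one {k N : ℕ} (h : 2 ^ (k - 1) ≤ N) : (k : ℝ) ≤ Real.logb 2 N + 1 := by
  have h1 : ((2 : ℝ) ^ (k - 1)) ≤ N := by exact_mod_cast h
  have h2 := Real.logb_le_logb_of_le (b := 2) (by norm_num) (by positivity) h1
  rw [Real.logb_pow, Real.logb_self_eq_one (by norm_num), mul_one] at h2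
  have h3 : (k : ℝ) ≤ ((k - 1 : ℕ) : ℝ) + 1 := by exact_mod_cast (by omega : k ≤ k - 1 + 1)
  linarith

lemma clog_succ_le {m : ℕ} (hm : 1 ≤ m) : (Nat.clog 2 (m + 1) : ℝ) ≤ Real.logb 2 m + 1 := by
  refine le_logb_add_one ?_
  have := Nat.pow_pred_clog_lt_self (b := 2) (by norm_num) (x := m + 1) (by omega)
  rw [Nat.pred_eq_sub_one] at this
  omega

lemma clog_le {N : ℕ} (hN : 1 ≤ N) : (Nat.clog 2 N : ℝ) ≤ Real.logb 2 N + 1 := by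
  refine le_logb_add_one ?_
  rcases hN.eq_or_lt with rfl | h
  · simp
  · have := Nat.pow_pred_clog_lt_self (b := 2) (by norm_num) (x := N) h
    rw [Nat.pred_eq_sub_one] at this
    omega

lemma clog_eq_succ {k : ℕ} (hk : 2 ≤ k) : Nat.clog 2 k = Nat.clog 2 (k - k / 2) + 1 := by
  rw [Nat.clog_of_two_le (by norm_num) hk]
  congr 2
  omega

/-- The rounded-up logarithm of the larger half is smaller by exactly one, which pays for the term
`k`. -/
lemma clog_halves_le {k : ℕ} (hk : 2 ≤ k) :
    k + (k / 2 * Nat.clog 2 (k / 2) + (k - k / 2) * Nat.clog 2 (k - k / 2)) ≤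
      k * Nat.clog 2 k := by
  have h1 := clog_eq_succ hk
  have h2 : Nat.clog 2 (k / 2) ≤ Nat.clog 2 (k - k / 2) := Nat.clog_mono_right 2 (by omega)
  calc _ ≤ k + (k / 2 * Nat.clog 2 (k - k / 2) + (k - k / 2) * Nat.clog 2 (k - k / 2)) := by gcongr
    _ = k + k * Nat.clog 2 (k - k / 2) := by rw [← add_mul]; congr 2; omega
    _ = _ := by rw [h1]; ring

/-- Halving raises the sum of the square roots by a factor of at least 4/3, even for odd k. A
potential k - √k therefore releases at least √k / 3 at every node. -/
lemma sqrt_halves_le {k : ℕ} (hk : 2 ≤ k) :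
    4 * √(k : ℝ) ≤ 3 * (√((k / 2 : ℕ) : ℝ) + √((k - k / 2 : ℕ) : ℝ)) := by
  set a := k / 2 with ha
  set b := k - k / 2 with hb
  have hab : (k : ℝ) = a + b := by exact_mod_cast (by omega : k = a + b)
  have h1 : (a : ℝ) ≤ b := by exact_mod_cast (by omega : a ≤ b)
  have h2 : (b : ℝ) ≤ 4 * a := by exact_mod_cast (by omega : b ≤ 4 * a)
  have s1 : √(a : ℝ) ^ 2 = a := Real.sq_sqrt (Nat.cast_nonneg a)
  have s2 : √(b : ℝ) ^ 2 = b := Real.sq_sqrt (Nat.cast_nonneg b)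
  have s3 : √(k : ℝ) ^ 2 = k := Real.sq_sqrt (Nat.cast_nonneg k)
  have p1 := Real.sqrt_nonneg (a : ℝ)
  have p2 := Real.sqrt_nonneg (b : ℝ)
  have q1 : √(a : ℝ) ≤ √(b : ℝ) := Real.sqrt_le_sqrt h1
  have q2 : √(b : ℝ) ≤ 2 * √(a : ℝ) := by
    refine (pow_le_pow_iff_left₀ p2 (by linarith) two_ne_zero).1 ?_
    rw [mul_pow, s1, s2]
    linarith
  refine (pow_le_pow_iff_left₀ (by positivity) (by positivity) two_ne_zero).1 ?_
  rw [mul_pow, s3, hab]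
  nlinarith [mul_nonneg (sub_nonneg.2 q1) (sub_nonneg.2 q2), mul_nonneg p1 (sub_nonneg.2 q2),
    mul_nonneg p1 p2]

end Logarithms

/-! ### Deterministic and randomized upper bounds -/

section Upper

variable {n m d : ℕ}

theorem solvable_det (hn : 1 ≤ n) (hd : m + 1 ≤ 2 ^ d) :
    Solvable False (Set.univ : Set (Fin n → Valuation m)) IsStructured
      (fun _ => 2 * (n * d) + n * d * Nat.clog 2 n) := by
  refine Solvable.structured hn hd (σ := fun k => k * d) (T := fun k => k * d * Nat.clog 2 k)
    ?_ (by simp) (fun k hk => ?_) (by positivity) (fun k hk hkn => ?_)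
  · exact fun key G a ha haG => Solvable.select_of_askAll (Nat.succ_pos m) hd key G ha haG.le
  · have h : ((k : ℝ) + ((k / 2 : ℕ) * Nat.clog 2 (k / 2) +
        (k - k / 2 : ℕ) * Nat.clog 2 (k - k / 2))) ≤ k * Nat.clog 2 k := by
      exact_mod_cast clog_halves_le hk
    have := mul_le_mul_of_nonneg_left h (Nat.cast_nonneg (α := ℝ) d)
    linarith
  · have : Nat.clog 2 k ≤ Nat.clog 2 n := Nat.clog_mono_right 2 hkn
    gcongr

/-- In the potential, -30 d √k pays for the 10 d √k of each selection and leaves O(d n) overall,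
while the linear part 5k recurs on every level and only accumulates to 5 n log n. -/
theorem solvable_rand (hn : 1 ≤ n) (hd : m + 1 ≤ 2 ^ d) :
    Solvable True (Set.univ : Set (Fin n → Valuation m)) IsStructured
      (fun _ => 2 * (n * d) + (5 * (n * Nat.clog 2 n) + 30 * (d * n))) := by
  refine Solvable.structured hn hd (σ := selectCost d)
    (T := fun k => 5 * (k * Nat.clog 2 k) + 30 * (d * (k - √k)))
    ?_ (by simp) (fun k hk => ?_) (by positivity) (fun k hk hkn => ?_)
  · exact fun key G a ha haG => (Solvable.quickselect (Nat.succ_pos m) hd key G haG).mono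
      subset_rfl (fun _ _ _ h => h.1) (fun _ _ => le_rfl)
  · have h : ((k : ℝ) + ((k / 2 : ℕ) * Nat.clog 2 (k / 2) +
        (k - k / 2 : ℕ) * Nat.clog 2 (k - k / 2))) ≤ k * Nat.clog 2 k := by
      exact_mod_cast clog_halves_le hk
    have hs := mul_le_mul_of_nonneg_left (sqrt_halves_le hk) (Nat.cast_nonneg (α := ℝ) d)
    have hab : (k : ℝ) = (k / 2 : ℕ) + (k - k / 2 : ℕ) := by
      exact_mod_cast (by omega : k = k / 2 + (k - k / 2))
    have hdk : (d : ℝ) * k = d * (k / 2 : ℕ) + d * (k - k / 2 : ℕ) := by rw [← mul_add, ← hab]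
    unfold selectCost
    linarith
  · have h1 : Nat.clog 2 k ≤ Nat.clog 2 n := Nat.clog_mono_right 2 hkn
    have h2 : (k : ℝ) - √k ≤ n := by
      have : (k : ℝ) ≤ n := by exact_mod_cast hkn
      linarith [Real.sqrt_nonneg (k : ℝ)]
    gcongr

end Upper

/-! ### Description complexity -/

section Description

variable {n m : ℕ} {ι X R : Type}

lemma Solvable.announce {rand : Prop} {D : Type} [Fintype D] [Nonempty D] {S : Set (ι → X)}
    {F : (ι → X) → R → Prop} {d : ℕ} (hd : Fintype.card D ≤ 2 ^ d) (i : ι) (decode : D → R)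
    (h : ∀ y, ∃ c, ∀ x ∈ S, x i = y → F x (decode c)) : Solvable rand S F (fun _ => d) := by
  choose f hf using h
  refine ((Solvable.ask i f hd).mono (Set.subset_univ _) (fun _ _ _ h => h)
    (fun _ _ => le_rfl)).map decode ?_
  rintro x hx r rfl
  exact hf (x i) x hx rfl

/-- A downward closed set of positions is an initial segment, determined by its size. -/
lemma lt_card_filter_iff {p : Fin m → Prop} [DecidablePred p]
    (hp : ∀ e e', e ≤ e' → p e' → p e) (e : Fin m) :
    (e : ℕ) < (Finset.univ.filter p).card ↔ p e := by
  constructor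
  · intro h
    by_contra hpe
    have : Finset.univ.filter p ⊆ Finset.Iio e := fun e' he' => by
      rw [Finset.mem_Iio]
      by_contra hle
      exact hpe (hp e e' (not_lt.1 hle) (Finset.mem_filter.1 he').2)
    have := Finset.card_le_card this
    rw [Fin.card_Iio] at this
    omega
  · intro h
    have : Finset.Iic e ⊆ Finset.univ.filter p := fun e' he' =>
      Finset.mem_filter.2 ⟨Finset.mem_univ _, hp e' e (Finset.mem_Iic.1 he') h⟩
    have := Finset.card_le_card this
    rw [Fin.card_Iic] at this
    omega

open Classical in
/-- The allocation in which agent `i` has the hole `(D i).2.2` and the other items at positions in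
`[(D i).1, (D i).2.1)`. -/
noncomputable def allocationOfBlocks [Nonempty (Fin n)]
    (D : Fin n → Fin (m + 1) × Fin (m + 1) × Option (Fin m)) : Allocation n m := fun e =>
  if h : ∃ i, (D i).2.2 = some e then h.choose
  else if h : ∃ i, ((D i).1 : ℕ) ≤ e ∧ (e : ℕ) < (D i).2.1 then h.choose
  else Classical.arbitrary _

/-- By monotonicity the block of an agent is the interval between the number of items in earlier
blocks and that number with her own block included. -/
lemma SemiContiguous.exists_allocationOfBlocks [Nonempty (Fin n)] {A : Allocation n m}
    (hA : SemiContiguous A) : ∃ D, allocationOfBlocks D = A := by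
  classical
  obtain ⟨blk, holes, σ, hmono, -, hblk, hinj⟩ := hA
  have hlt : ∀ (p : Fin m → Prop) [DecidablePred p], (Finset.univ.filter p).card < m + 1 := by
    intro p _
    have := Finset.card_filter_le (Finset.univ : Finset (Fin m)) p
    rw [Finset.card_univ, Fintype.card_fin] at this
    omega
  let D : Fin n → Fin (m + 1) × Fin (m + 1) × Option (Fin m) := fun i =>
    (⟨_, hlt fun e => blk e < σ i⟩, ⟨_, hlt fun e => blk e ≤ σ i⟩,
      if h : ∃ e, e ∈ holes ∧ A e = i then some h.choose else none)
  have hhole : ∀ i e, (D i).2.2 = some e ↔ e ∈ holes ∧ A e = i := by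
    intro i e
    simp only [D]
    constructor
    · intro h
      split_ifs at h with h'
      rw [← Option.some_inj.1 h]
      exact h'.choose_spec
    · intro h
      have hex : ∃ e, e ∈ holes ∧ A e = i := ⟨e, h⟩
      rw [dif_pos hex]
      exact congrArg some (hinj hex.choose_spec.1 h.1 (hex.choose_spec.2.trans h.2.symm))
  have hpos : ∀ i (e : Fin m), ((D i).1 : ℕ) ≤ e ∧ (e : ℕ) < (D i).2.1 ↔ blk e = σ i := by
    intro i e
    have h1 := lt_card_filter_iff (p := fun e => blk e < σ i)
      (fun e e' h h' => (hmono h).trans_lt h') e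
    have h2 := lt_card_filter_iff (p := fun e => blk e ≤ σ i)
      (fun e e' h h' => (hmono h).trans h') e
    change (Finset.univ.filter fun e => blk e < σ i).card ≤ (e : ℕ) ∧
      (e : ℕ) < (Finset.univ.filter fun e => blk e ≤ σ i).card ↔ _
    rw [h2, ← not_lt, h1, not_lt]
    exact ⟨fun h => le_antisymm h.2 h.1, fun h => ⟨h.ge, h.le⟩⟩
  refine ⟨D, funext fun e => ?_⟩
  unfold allocationOfBlocks
  by_cases he : e ∈ holes
  · have h : ∃ i, (D i).2.2 = some e := ⟨A e, (hhole _ _).2 ⟨he, rfl⟩⟩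
    rw [dif_pos h]
    exact ((hhole _ _).1 h.choose_spec).2.symm
  · have h : ¬ ∃ i, (D i).2.2 = some e := fun ⟨i, hi⟩ => he ((hhole _ _).1 hi).1
    have h' : ∃ i, ((D i).1 : ℕ) ≤ e ∧ (e : ℕ) < (D i).2.1 := ⟨A e, (hpos _ _).2 (hblk e he)⟩
    rw [dif_neg h, dif_pos h']
    exact σ.injective (((hpos _ _).1 h'.choose_spec).symm.trans (hblk e he))

theorem descC_aprop_le (hn : 1 ≤ n) {d : ℕ} (hd : m + 1 ≤ 2 ^ d)
    (hex : ∀ v : Fin n → Valuation m, ∃ A : Allocation n m, SemiContiguous A ∧ Aprop v A) :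
    descC Aprop (additive n m) ≤ ENNReal.ofReal (3 * (n * d)) := by
  have : Nonempty (Fin n) := ⟨⟨0, by omega⟩⟩
  have hcard : Fintype.card (Fin n → Fin (m + 1) × Fin (m + 1) × Option (Fin m)) ≤
      2 ^ (3 * (n * d)) := by
    rw [Fintype.card_fun, Fintype.card_prod, Fintype.card_prod, Fintype.card_option,
      Fintype.card_fin, Fintype.card_fin, Fintype.card_fin]
    calc ((m + 1) * ((m + 1) * (m + 1))) ^ n ≤ (2 ^ d * (2 ^ d * 2 ^ d)) ^ n := by gcongr
      _ = 2 ^ (3 * (n * d)) := by rw [← pow_add, ← pow_add, ← pow_mul]; congr 1; ring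
  have h : Solvable False {w : Unit → Fin n → Valuation m | w () ∈ additive n m}
      (fun w A => Aprop (w ()) A) (fun _ => ((3 * (n * d) : ℕ) : ℝ)) := by
    refine Solvable.announce hcard () allocationOfBlocks fun v => ?_
    obtain ⟨A, h1, h2⟩ := hex v
    obtain ⟨D, rfl⟩ := h1.exists_allocationOfBlocks
    exact ⟨D, fun w _ hw => by rw [hw]; exact h2⟩
  exact_mod_cast h.detCC_le

end Description

/-! ### Identical valuations -/

section Identical

variable {n m : ℕ}

/-- Weight each set T by (n/N)^|T|. All weights sum to (1 + n/N)^N ≤ e^n, and every set counted has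
weight at least (n/N)^n. -/
lemma card_small_subsets_le {N : ℕ} (hn : 1 ≤ n) (hN : n ≤ N) :
    (Fintype.card {T : Finset (Fin N) // T.card ≤ n} : ℝ) ≤ (4 * N / n) ^ n := by
  classical
  have hn' : (0 : ℝ) < n := by exact_mod_cast hn
  have hN' : (0 : ℝ) < N := by exact_mod_cast hn.trans hN
  have hx0 : (0 : ℝ) < n / N := by positivity
  have hx1 : (n / N : ℝ) ≤ 1 := by
    rw [div_le_one hN']; exact_mod_cast hN
  have h1 : (Fintype.card {T : Finset (Fin N) // T.card ≤ n} : ℝ) * (n / N : ℝ) ^ n ≤ 4 ^ n := by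
    calc _ = ∑ T ∈ Finset.univ.filter (fun T : Finset (Fin N) => T.card ≤ n), (n / N : ℝ) ^ n := by
          rw [Fintype.card_subtype, Finset.sum_const, nsmul_eq_mul]
      _ ≤ ∑ T ∈ Finset.univ.filter (fun T : Finset (Fin N) => T.card ≤ n),
            (n / N : ℝ) ^ T.card := by
          refine Finset.sum_le_sum fun T hT => ?_
          exact pow_le_pow_of_le_one hx0.le hx1 (Finset.mem_filter.1 hT).2
      _ ≤ ∑ T : Finset (Fin N), (n / N : ℝ) ^ T.card :=
          Finset.sum_le_sum_of_subset_of_nonneg (Finset.filter_subset _ _)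
            fun _ _ _ => by positivity
      _ = (n / N + 1 : ℝ) ^ N := by
          have := Finset.sum_pow_mul_eq_add_pow (n / N : ℝ) 1 (Finset.univ : Finset (Fin N))
          simpa using this
      _ ≤ Real.exp (n / N) ^ N := by gcongr; exact Real.add_one_le_exp _
      _ = Real.exp 1 ^ n := by
          rw [← Real.exp_nat_mul, ← Real.exp_nat_mul]; congr 1; field_simp
      _ ≤ 4 ^ n := by
          gcongr
          exact Real.exp_one_lt_d9.le.trans (by norm_num)
  rw [← le_div_iff₀ (by positivity)] at h1
  refine h1.trans (le_of_eq ?_)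
  rw [← div_pow]
  congr 1
  field_simp

/-- A monotone map, encoded as a set of at most `n` elements of `Fin (m + n)`. -/
def blockCode (blk : Fin m → Fin n) : Finset (Fin (m + n)) :=
  Finset.univ.filter fun c => ∀ e : Fin m, (c : ℕ) ≠ e + blk e

/-- Stars and bars: adding the position makes a monotone map strictly monotone, hence determined by
its range, and the complement of this range in `Fin (m + n)` has only n elements. -/
lemma strictMono_add {blk : Fin m → Fin n} (h : Monotone blk) :
    StrictMono fun e : Fin m => (⟨e + blk e, by omega⟩ : Fin (m + n)) := by
  intro e e' hee
  have h1 : (blk e : ℕ) ≤ blk e' := h hee.le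
  have h2 : (e : ℕ) < e' := hee
  exact Fin.mk_lt_mk.2 (by omega)

lemma card_blockCode {blk : Fin m → Fin n} (h : Monotone blk) : (blockCode blk).card ≤ n := by
  classical
  have h1 : blockCode blk = Finset.univ \ Finset.univ.image
      fun e : Fin m => (⟨e + blk e, by omega⟩ : Fin (m + n)) := by
    ext c
    simp only [blockCode, Finset.mem_filter, Finset.mem_univ, true_and, Finset.mem_sdiff,
      Finset.mem_image, not_exists, Fin.ext_iff]
    exact forall_congr' fun e => ne_comm
  rw [h1, Finset.card_sdiff_of_subset (Finset.subset_univ _),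
    Finset.card_image_of_injective _ (strictMono_add h).injective]
  simp

lemma blockCode_inj {blk blk' : Fin m → Fin n} (h : Monotone blk) (h' : Monotone blk')
    (hc : blockCode blk = blockCode blk') : blk = blk' := by
  have hr : Set.range (fun e : Fin m => (⟨e + blk e, by omega⟩ : Fin (m + n))) =
      Set.range fun e : Fin m => (⟨e + blk' e, by omega⟩ : Fin (m + n)) := by
    ext c
    have := Finset.ext_iff.1 hc c
    simp only [blockCode, Finset.mem_filter, Finset.mem_univ, true_and] at this
    rw [← not_iff_not]
    simp only [Set.mem_range, not_exists, Fin.ext_iff]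
    exact (forall_congr' fun e => ne_comm).trans (this.trans (forall_congr' fun e => ne_comm))
  have := ((strictMono_add h).range_inj (strictMono_add h')).1 hr
  funext e
  have h2 := congrArg Fin.val (congrFun this e)
  exact Fin.ext (by simpa using h2)

open Classical in
/-- The allocation described by a code `T` of the blocks, a set `S` of single items, and one further
hole with its owner `j`. -/
noncomputable def allocationOfCode (T : Finset (Fin (m + n))) (S : Finset (Fin m))
    (hole : Option (Fin m)) (j : Fin n) : Allocation n m := fun e =>
  if e ∈ S then (if h : n - S.card + rankIn S e < n then ⟨_, h⟩ else j)
  else if hole = some e then j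
  else if h : ∃ blk : Fin m → Fin n, Monotone blk ∧ blockCode blk = T then h.choose e
  else j

lemma Aprop.comp_perm {u : Valuation m} {A : Allocation n m} (h : Aprop (fun _ => u) A)
    (σ : Equiv.Perm (Fin n)) : Aprop (fun _ => u) (fun e => σ (A e) : Allocation n m) := by
  have hb : ∀ i, Allocation.bundle (fun e => σ (A e) : Allocation n m) i = A.bundle (σ.symm i) := by
    intro i
    ext e
    simp [Allocation.bundle, Equiv.eq_symm_apply]
  obtain ⟨h1, h2⟩ := h
  refine ⟨fun i => ?_, fun i => ?_⟩
  · rw [hb]; exact h1 (σ.symm i)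
  · rw [hb]; exact h2 (σ.symm i)

/-- With a common valuation the names of the agents are immaterial, so the permutation is removed by
relabelling: the owner of a plain item becomes the number of its block, that of a taken item follows
from its rank, and only the one further hole needs an explicit owner. -/
lemma IsStructured.exists_code (hn : 1 ≤ n) {u : Valuation m} {A : Allocation n m}
    (h : IsStructured (fun _ => u) A) :
    ∃ (T : {T : Finset (Fin (m + n)) // T.card ≤ n}) (S : {S : Finset (Fin m) // S.card ≤ n})
      (hole : Option (Fin m)) (j : Fin n),
      Aprop (fun _ => u) (allocationOfCode T.1 S.1 hole j) := by
  classical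
  obtain ⟨hA, blk, σ, S, H, h1, h2, h3, h4, h5, h6⟩ := h
  have hH := h6 ⟨u, fun _ => rfl⟩
  obtain ⟨hole, j, hhole⟩ : ∃ (hole : Option (Fin m)) (j : Fin n),
      ∀ e, (hole = some e ↔ e ∈ H) ∧ (e ∈ H → j = σ (A e)) := by
    rcases H.eq_empty_or_nonempty with rfl | ⟨e, he⟩
    · exact ⟨none, ⟨0, by omega⟩, by simp⟩
    · refine ⟨some e, σ (A e), fun e' => ⟨⟨fun h => ?_, fun h => ?_⟩, fun h => ?_⟩⟩
      · rwa [← Option.some_inj.1 h]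
      · rw [Finset.card_le_one.1 hH e he e' h]
      · rw [Finset.card_le_one.1 hH e he e' h]
  refine ⟨⟨blockCode blk, card_blockCode h1⟩, ⟨S, by omega⟩, hole, j, ?_⟩
  convert hA.comp_perm σ using 1
  funext e
  unfold allocationOfCode
  by_cases heS : e ∈ S
  · have hlt : n - S.card + rankIn S e < n := by
      rw [← h4 e heS]; exact (σ (A e)).2
    rw [if_pos heS, dif_pos hlt]
    exact Fin.ext (h4 e heS).symm
  rw [if_neg heS]
  by_cases heH : e ∈ H
  · rw [if_pos ((hhole e).1.2 heH), (hhole e).2 heH]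
  · rw [if_neg fun h => heH ((hhole e).1.1 h)]
    have hex : ∃ blk' : Fin m → Fin n, Monotone blk' ∧ blockCode blk' = blockCode blk :=
      ⟨blk, h1, rfl⟩
    rw [dif_pos hex, blockCode_inj hex.choose_spec.1 h1 hex.choose_spec.2]
    exact h3 e heS heH

lemma one_le_logb_div (hn : 1 ≤ n) (hm : 2 * n ≤ m) : 1 ≤ Real.logb 2 ((m : ℝ) / n) := by
  have hn' : (0 : ℝ) < n := by exact_mod_cast hn
  have h : (2 : ℝ) ≤ m / n := by rw [le_div_iff₀ hn']; exact_mod_cast hm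
  have := Real.logb_le_logb_of_le (b := 2) (by norm_num) (by norm_num) h
  rwa [Real.logb_self_eq_one (by norm_num)] at this

lemma logb_natCast_le (hn : 1 ≤ n) : Real.logb 2 n ≤ n - 1 := by
  have h : (n : ℝ) ≤ 2 ^ (n - 1) := by
    have : n - 1 < 2 ^ (n - 1) := Nat.lt_two_pow_self
    exact_mod_cast (by omega : n ≤ 2 ^ (n - 1))
  have := Real.logb_le_logb_of_le (b := 2) (by norm_num) (by exact_mod_cast hn) h
  rw [Real.logb_pow, Real.logb_self_eq_one (by norm_num), Nat.cast_sub hn] at this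
  simpa using this

theorem detCC_identical_le (hn : 1 ≤ n) (hm : 2 * n ≤ m)
    (hex : ∀ v : Fin n → Valuation m, ∃ A : Allocation n m, IsStructured v A) :
    detCC Aprop (identical n m) ≤ ENNReal.ofReal (11 * (n * Real.logb 2 (m / n))) := by
  classical
  let D := {T : Finset (Fin (m + n)) // T.card ≤ n} × {S : Finset (Fin m) // S.card ≤ n} ×
    Option (Fin m) × Fin n
  have hD : Nonempty D := ⟨⟨∅, by simp⟩, ⟨∅, by simp⟩, none, ⟨0, by omega⟩⟩
  have hsolv : Solvable False (identical n m) Aprop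
      (fun _ => (Nat.clog 2 (Fintype.card D) : ℝ)) := by
    -- One agent knows the common valuation, so she can announce the code of a suitable allocation
    -- alone.
    refine Solvable.announce (D := D) (Nat.le_pow_clog (by norm_num) _) ⟨0, by omega⟩
      (fun c => allocationOfCode c.1.1 c.2.1.1 c.2.2.1 c.2.2.2) fun u => ?_
    obtain ⟨A, hA⟩ := hex fun _ => u
    obtain ⟨T, S, hole, j, h⟩ := hA.exists_code hn
    refine ⟨(T, S, hole, j), ?_⟩
    rintro x ⟨u', hu'⟩ hx
    have : x = fun _ => u := funext fun i => (hu' i).trans ((hu' _).symm.trans hx)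
    rw [this]
    exact h
  refine hsolv.detCC_le.trans (ENNReal.ofReal_le_ofReal ?_)
  have hn' : (1 : ℝ) ≤ n := by exact_mod_cast hn
  have hm' : (2 : ℝ) * n ≤ m := by exact_mod_cast hm
  have hm0 : (0 : ℝ) < m := by linarith
  have hl := one_le_logb_div hn hm
  have hlog := logb_natCast_le hn
  have hlm : Real.logb 2 m = Real.logb 2 ((m : ℝ) / n) + Real.logb 2 n := by
    rw [Real.logb_div (by linarith) (by linarith)]; ring
  have hcard : (Fintype.card D : ℝ) ≤
      (8 * (m / n)) ^ n * ((4 * (m / n)) ^ n * ((2 * m) * n)) := by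
    have c1 := card_small_subsets_le (N := m + n) hn (by omega)
    have c2 := card_small_subsets_le (N := m) hn (by omega)
    have e1 : (4 * ((m + n : ℕ) : ℝ) / n) ^ n ≤ (8 * (m / n : ℝ)) ^ n := by
      refine pow_le_pow_left₀ (by positivity) ?_ n
      rw [← mul_div_assoc, div_le_div_iff_of_pos_right (by linarith)]
      push_cast
      linarith
    simp only [D, Fintype.card_prod, Fintype.card_option, Fintype.card_fin]
    push_cast
    refine mul_le_mul (c1.trans e1) (mul_le_mul (c2.trans (le_of_eq ?_)) ?_ (by positivity)
      (by positivity)) (by positivity) (by positivity)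
    · rw [mul_div_assoc]
    · refine mul_le_mul_of_nonneg_right ?_ (by positivity)
      linarith
  have hpos : 0 < Fintype.card D := Fintype.card_pos
  have h1 := clog_le (N := Fintype.card D) hpos
  have h2 := Real.logb_le_logb_of_le (b := 2) (by norm_num)
    (by exact_mod_cast hpos : (0 : ℝ) < Fintype.card D) hcard
  have l8 : Real.logb 2 8 = 3 := by
    rw [show (8 : ℝ) = 2 ^ 3 by norm_num, Real.logb_pow, Real.logb_self_eq_one (by norm_num)]
    norm_num
  have l4 : Real.logb 2 4 = 2 := by
    rw [show (4 : ℝ) = 2 ^ 2 by norm_num, Real.logb_pow, Real.logb_self_eq_one (by norm_num)]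
    norm_num
  have hmn : (m / n : ℝ) ≠ 0 := (div_pos hm0 (by linarith)).ne'
  rw [Real.logb_mul (by positivity) (by positivity), Real.logb_mul (by positivity) (by positivity),
    Real.logb_mul (by positivity) (by positivity), Real.logb_mul (by positivity) (by positivity),
    Real.logb_pow, Real.logb_pow, Real.logb_mul (by positivity) hmn,
    Real.logb_mul (by positivity) hmn, Real.logb_self_eq_one (by norm_num), l8, l4, hlm] at h2
  set l := Real.logb 2 ((m : ℝ) / n)
  nlinarith [mul_nonneg (sub_nonneg.2 hn') (sub_nonneg.2 hl)]

end Identical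

end FairAllocation

/-! ### Assembly of the bounds -/

theorem theorem5 :
    -- absolute constants, and a leading factor `1 + ε n` with `ε n → 0`
    ∃ (C c : ℝ) (ε : ℕ → ℝ), 0 < C ∧ 0 < c ∧ Filter.Tendsto ε Filter.atTop (𝓝 0) ∧
      ∀ n m : ℕ, 1 ≤ n → 2 * n ≤ m →
        -- deterministic communication complexity
        detCC Aprop (additive n m) ≤
          ENNReal.ofReal (C * (n * Real.logb 2 m * Real.logb 2 n)) ∧
        detCC Aprop (additive n m) ≤
          ENNReal.ofReal ((1 + ε n) * (n * Real.logb 2 m * Real.logb 2 n)) ∧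
        -- randomized communication complexity
        randCC Aprop (additive n m) ≤ ENNReal.ofReal (C * (n * Real.logb 2 m)) ∧
        -- existence of semi-contiguous allocations, and description complexity
        (∀ v ∈ additive n m, ∃ A : Allocation n m, SemiContiguous A ∧ Aprop v A) ∧
        descC Aprop (additive n m) ≤ ENNReal.ofReal (C * (n * Real.logb 2 m)) ∧
        -- upper bounds for identical valuations
        detCC Aprop (identical n m) ≤ ENNReal.ofReal (C * (n * Real.logb 2 (m / n))) ∧
        randCC Aprop (identical n m) ≤ ENNReal.ofReal (C * (n * Real.logb 2 (m / n))) ∧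
        -- lower bounds, for at least two agents
        (2 ≤ n →
          ENNReal.ofReal (c * (n * Real.logb 2 (m / n))) ≤ randCC Prop1 (identicalBinary n m) ∧
          ENNReal.ofReal (c * (n * Real.logb 2 (m / n))) ≤ randCC Aprop (additive n m) ∧
          ENNReal.ofReal (c * (n * Real.logb 2 (m / n))) ≤ randCC Aprop (identical n m) ∧
          ENNReal.ofReal (c * (n * Real.logb 2 (m / n))) ≤ detCC Aprop (identical n m)) := by
  -- Since d ≤ log m + 1 ≤ 2 log m and the rounded-up log n is at most log m, the randomized cost is
  -- at most (32 · 2 + 5) n log m. The 7 bounds the lower-order terms in (log m + 1)(log n + 3) ≤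
  -- log m log n + 7 log m.
  refine ⟨69, 1 / 16, fun n => 7 / Real.logb 2 n, by norm_num, by norm_num, ?_,
    fun n m hn hm => ?_⟩
  · exact Filter.Tendsto.const_div_atTop
      ((Real.tendsto_logb_atTop (by norm_num)).comp tendsto_natCast_atTop_atTop) 7
  have hn' : (1 : ℝ) ≤ n := by exact_mod_cast hn
  have hm' : (2 : ℝ) * n ≤ m := by exact_mod_cast hm
  set d := Nat.clog 2 (m + 1) with hd'
  have hd : m + 1 ≤ 2 ^ d := Nat.le_pow_clog (by norm_num) _
  have hdl : (d : ℝ) ≤ Real.logb 2 m + 1 := clog_succ_le (by omega)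
  have hcl : (Nat.clog 2 n : ℝ) ≤ Real.logb 2 n + 1 := clog_le hn
  have hlm : Real.logb 2 m = Real.logb 2 ((m : ℝ) / n) + Real.logb 2 n := by
    rw [Real.logb_div (by linarith) (by linarith)]; ring
  have hl := one_le_logb_div hn hm
  have hlogn : 0 ≤ Real.logb 2 n := Real.logb_nonneg (by norm_num) hn'
  have hnl : Real.logb 2 n + 1 ≤ Real.logb 2 m := by linarith
  have hnn : (0 : ℝ) ≤ n := by linarith
  have hdet := solvable_det hn hd
  have hex : ∀ v : Fin n → Valuation m, ∃ A : Allocation n m, IsStructured v A := fun v =>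
    hdet.exists_output (Set.mem_univ v)
  have hsemi : ∀ v : Fin n → Valuation m, ∃ A : Allocation n m, SemiContiguous A ∧ Aprop v A :=
    fun v => by
      obtain ⟨A, hA⟩ := hex v
      exact ⟨A, hA.semiContiguous, hA.1⟩
  have hident : detCC Aprop (identical n m) ≤
      ENNReal.ofReal (69 * (n * Real.logb 2 (m / n))) :=
    (detCC_identical_le hn hm hex).trans (ENNReal.ofReal_le_ofReal (by
      have : 0 ≤ n * Real.logb 2 ((m : ℝ) / n) := mul_nonneg hnn (by linarith)
      linarith))
  have hdetCC : detCC Aprop (additive n m) ≤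
      ENNReal.ofReal ((1 + 7 / Real.logb 2 n) * (n * Real.logb 2 m * Real.logb 2 n)) ∧
      detCC Aprop (additive n m) ≤
        ENNReal.ofReal (69 * (n * Real.logb 2 m * Real.logb 2 n)) := by
    rcases hn.eq_or_lt with rfl | hn2
    -- For n = 1 both bounds are 0, as log 1 = 0, and the single agent receives everything without
    -- communication.
    · have h : Solvable False (additive 1 m) Aprop (fun _ => 0) := by
        refine Solvable.pure (fun _ => 0) (fun x _ => aprop_of_suffices le_rfl fun i => ?_) (by simp)
        refine (suffices_univ le_rfl (x i)).mono fun e _ => ?_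
        simp [Allocation.bundle, Subsingleton.elim i 0]
      simpa using h.detCC_le
    · have hk : 1 ≤ Real.logb 2 n := by
        have h2 : (2 : ℝ) ≤ n := by exact_mod_cast hn2
        have := Real.logb_le_logb_of_le (b := 2) (by norm_num) (by norm_num) h2
        rwa [Real.logb_self_eq_one (by norm_num)] at this
      have h := (hdet.mono subset_rfl (fun _ _ _ h => h.1) (fun _ _ => le_rfl)).detCC_le
      have hbound : 2 * (n * (d : ℝ)) + n * d * Nat.clog 2 n ≤
          n * Real.logb 2 m * Real.logb 2 n + 7 * (n * Real.logb 2 m) := by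
        have h1 : 2 * (d : ℝ) + d * Nat.clog 2 n ≤
            Real.logb 2 m * Real.logb 2 n + 7 * Real.logb 2 m := by
          have : (d : ℝ) * (2 + Nat.clog 2 n) ≤ (Real.logb 2 m + 1) * (Real.logb 2 n + 3) :=
            mul_le_mul hdl (by linarith) (by positivity) (by linarith)
          nlinarith
        nlinarith [mul_le_mul_of_nonneg_left h1 hnn]
      refine ⟨h.trans (ENNReal.ofReal_le_ofReal (hbound.trans (le_of_eq ?_))),
        h.trans (ENNReal.ofReal_le_ofReal (hbound.trans ?_))⟩
      · field_simp
      · have : n * Real.logb 2 m ≤ n * Real.logb 2 m * Real.logb 2 n :=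
          le_mul_of_one_le_right (mul_nonneg hnn (by linarith)) hk
        have : 0 ≤ n * Real.logb 2 m := mul_nonneg hnn (by linarith)
        linarith
  refine ⟨hdetCC.2, hdetCC.1, ?_, fun v _ => hsemi v, ?_, hident,
    (randCC_le_detCC _ _).trans hident, fun hn2 => ?_⟩
  · refine ((solvable_rand hn hd).mono subset_rfl (fun _ _ _ h => h.1)
      (fun _ _ => le_rfl)).randCC_le.trans (ENNReal.ofReal_le_ofReal ?_)
    have h1 := mul_le_mul_of_nonneg_left hdl hnn
    have h2 := mul_le_mul_of_nonneg_left (hcl.trans hnl) hnn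
    nlinarith
  · refine (descC_aprop_le hn hd hsemi).trans (ENNReal.ofReal_le_ofReal ?_)
    have h1 := mul_le_mul_of_nonneg_left hdl hnn
    nlinarith
  · have hlow := le_randCC_prop1 hn2 hm
    have hsub : identicalBinary n m ⊆ identical n m := fun x ⟨u, _, hu⟩ => ⟨u, hu⟩
    have hid := hlow.trans (randCC_mono (F' := Aprop) hsub fun _ _ _ h => h.1)
    exact ⟨hlow, hid.trans (randCC_mono (Set.subset_univ _) fun _ _ _ h => h), hid,
      hid.trans (randCC_le_detCC _ _)⟩
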